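/- Write points of $T^*\mathbf R^3=\mathbf R^6$ as $(x,\xi)$ with $x=(s,z)$, $\xi=(\sigma,\zeta)$, $s,\sigma\in\mathbf R$, $z=(z_1,z_2)$, $\zeta=(\zeta_1,\zeta_2)\in\mathbf R^2$. A (scalar) symbol on $\mathbf R^N$ is a smooth function $f$ for which there is $m\in\mathbf N$ such that every derivative of $f$ is bounded by a constant (depending on the derivative) times $(1+|X|)^m$; a matrix-valued function is a symbol if its entries are. For a symbol $a$ on $\mathbf R^6$ with values in $\mathbf C^{3\times3}$ and $\varepsilon>0$ let $$\mathrm{op}_\varepsilon(a)u(x)=(2\pi\varepsilon)^{-3}\int_{\mathbf R^3}\int_{\mathbf R^3}a\Big(\frac{x+y}2,\xi\Big)e^{\frac i\varepsilon\xi\cdot(x-y)}u(y)\,dy\,d\xi ,\qquad u\in\mathcal S(\mathbf R^3,\mathbf C^3),$$ and for a symbol $a=a(s,z,\sigma,\zeta,\eta)$ on $\mathbf R^7$ let $\mathrm{op}^I_\varepsilon(a)=\mathrm{op}_\varepsilon\big(a(s,z,\sigma,\zeta,z_1/\sqrt\varepsilon)\big)$. Set $$J=\begin{pmatrix}1&0&0\\0&-1&0\\0&0&0\end{pmatrix},\qquad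 L=\frac1{\sqrt2}\begin{pmatrix}0&0&1\\0&0&1\\1&1&0\end{pmatrix}.$$ Let $\alpha=\alpha(\sigma,\zeta)$ be a real-valued symbol on $\mathbf R^3$ and $$Q=-\sigma\,\mathrm{Id}+sJ+\sqrt\varepsilon\,\alpha(\sigma,\zeta)\,\eta L,\qquad Q_0=-\sigma\,\mathrm{Id}+sJ+\sqrt\varepsilon\,\alpha(0,\zeta)\,\eta L ,$$ where $\mathrm{op}_\varepsilon(Q)$, $\mathrm{op}_\varepsilon(Q_0)$ are understood with $\eta=z_1/\sqrt\varepsilon$. Then for every ball $B$ of $\mathbf R_\eta$ there exist $\mathbf C^{3\times 3}$-valued symbols $C$ and $\tilde C$ on $\mathbf R^7$, independent of $\varepsilon$, such that for every $a\in\mathcal C_0^\infty(\mathbf R^6\times B,\mathbf C^{3\times3})$ the operator $$\mathrm{op}^I_\varepsilon(a)\Big[\mathrm{op}^I_\varepsilon(\mathrm{Id}+\sqrt\varepsilon\,C)\,\mathrm{op}_\varepsilon(Q)-\mathrm{op}_\varepsilon(Q_0)\,\mathrm{op}^I_\varepsilon(\mathrm{Id}+\sqrt\varepsilon\,\tilde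 C)\Big],$$ defined on $\mathcal S(\mathbf R^3,\mathbf C^3)$, extends for every $\varepsilon>0$ to a bounded operator on $L^2(\mathbf R^3,\mathbf C^3)$, whose norm is $O(\varepsilon)$ as $\varepsilon\to0^+$. -/

import Mathlib

open MeasureTheory Filter Topology Asymptotics
open scoped ContDiff SchwartzMap Matrix

noncomputable section

/-- The space `ℝ³`. A position is `x = (x 0, x 1, x 2) = (s, z₁, z₂)` and the dual momentum is
`ξ = (ξ 0, ξ 1, ξ 2) = (σ, ζ₁, ζ₂)`. -/
abbrev R3 : Type := EuclideanSpace ℝ (Fin 3)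

/-- The space `ℂ³` in which the wave functions take their values. -/
abbrev C3 : Type := EuclideanSpace ℂ (Fin 3)

/-- Complex `3 × 3` matrices. -/
abbrev Mat3 : Type := Matrix (Fin 3) (Fin 3) ℂ

/-- The Hilbert space `L²(ℝ³, ℂ³)`. -/
abbrev L2R3 : Type := Lp C3 2 (volume : Measure R3)

/-- Scalar symbols: smooth functions all of whose derivatives are bounded by a multiple of
`(1 + ‖x‖) ^ m`, with an order of growth `m` that is the same for all the derivatives. -/
def IsSymbol {E F : Type*} [NormedAddCommGroup E] [NormedSpace ℝ E]
    [NormedAddCommGroup F] [NormedSpace ℝ F] (f : E → F) : Prop :=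
  ContDiff ℝ ∞ f ∧
    ∃ m : ℕ, ∀ k : ℕ, ∃ K : ℝ, ∀ x : E, ‖iteratedFDeriv ℝ k f x‖ ≤ K * (1 + ‖x‖) ^ m

/-- Matrix-valued symbols: every entry is a symbol. -/
def IsMatrixSymbol {E : Type*} [NormedAddCommGroup E] [NormedSpace ℝ E] (C : E → Mat3) : Prop :=
  ∀ i j : Fin 3, IsSymbol fun p => C p i j

/-- The semiclassical Weyl quantization on `ℝ³` of a matrix-valued symbol `a = a(x, ξ)`,
`op_ε(a) u (x) = (2πε)⁻³ ∫ ∫ a((x + y)/2, ξ) e^{(i/ε) ξ·(x - y)} u(y) dy dξ`. The integral in `y`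
is taken first; for a symbol `a` and a Schwartz function `u` both integrals converge absolutely. -/
def weylOp (ε : ℝ) (a : R3 × R3 → Mat3) (u : R3 → C3) : R3 → C3 := fun x =>
  (((2 * Real.pi * ε) ^ 3)⁻¹ : ℝ) •
    ∫ ξ : R3, ∫ y : R3,
      Complex.exp (Complex.I / (ε : ℂ) * (inner ℝ ξ (x - y) : ℝ)) •
        WithLp.toLp 2 (a ((2 : ℝ)⁻¹ • (x + y), ξ) *ᵥ (u y).ofLp)

/-- The two-microlocal quantization `op^I_ε(a) = op_ε(a(s, z, σ, ζ, z₁ / √ε))` associated with the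
hypersurface `I = {z₁ = 0}`, for a function `a = a(x, ξ, η)`, `x = (s, z)`, `ξ = (σ, ζ)`. -/
def opI (ε : ℝ) (a : R3 × R3 × ℝ → Mat3) : (R3 → C3) → (R3 → C3) :=
  weylOp ε fun p => a (p.1, p.2, p.1 1 / √ε)

/-- `J = diag(1, -1, 0)`. -/
def matJ : Mat3 := !![1, 0, 0; 0, -1, 0; 0, 0, 0]

/-- `L = 2^{-1/2} ((0, 0, 1), (0, 0, 1), (1, 1, 0))`. -/
def matL : Mat3 := (((√2)⁻¹ : ℝ) : ℂ) • !![0, 0, 1; 0, 0, 1; 1, 1, 0]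

/-- `Q = -σ Id + s J + √ε α(σ, ζ) η L`. -/
def symbQ (α : R3 → ℝ) (ε : ℝ) : R3 × R3 × ℝ → Mat3 := fun (x, ξ, η) =>
  -((ξ 0 : ℝ) : ℂ) • (1 : Mat3) + ((x 0 : ℝ) : ℂ) • matJ + ((√ε * α ξ * η : ℝ) : ℂ) • matL

/-- `Q₀ = -σ Id + s J + √ε α(0, ζ) η L`. -/
def symbQ0 (α : R3 → ℝ) (ε : ℝ) : R3 × R3 × ℝ → Mat3 :=
  symbQ (fun ξ => α !₂[0, ξ 1, ξ 2]) ε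

/-- `Id + √ε C`. -/
def idAdd (ε : ℝ) (C : R3 × R3 × ℝ → Mat3) : R3 × R3 × ℝ → Mat3 := fun p =>
  1 + ((√ε : ℝ) : ℂ) • C p

/-- The operator `op^I_ε(a) [op^I_ε(Id + √ε C) op_ε(Q) - op_ε(Q₀) op^I_ε(Id + √ε C')]`, where
`η = z₁ / √ε` is understood in `Q` and `Q₀`. -/
def nfDefect (α : R3 → ℝ) (C C' a : R3 × R3 × ℝ → Mat3) (ε : ℝ) (u : R3 → C3) : R3 → C3 :=
  opI ε a
    (opI ε (idAdd ε C) (opI ε (symbQ α ε) u) - opI ε (symbQ0 α ε) (opI ε (idAdd ε C') u))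

end

/-! Since `√ε η = z₁`, none of the symbols in the bracket really depends on `√ε`: with `α₀(ζ) =
α(0, ζ)`, `S = σ(εD)` and `N_F` the Weyl quantization of `z₁ F(ξ)`, the operators of `Q` and `Q₀`
are `-S + s J + N_α L` and `-S + s J + N_{α₀} L`. By Hadamard's formula `α = α₀ + σ β` for a
symbol `β` (`coord_mul_hadamardQuotient`, `isSymbol_hadamardQuotient`), and `z₁` commutes with
`S`, so `N_α = N_{α₀} + S N_β = N_{α₀} + N_β S`.

Let `P` be the projection on the kernel of `J`. Then `P J = J P = 0` and `L P + P L = L`. For `C =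
η β L P` and `C' = -η β P L` the operators of `Id + √ε C` and `Id + √ε C'` are `1 + N_β L P` and
`1 - N_β P L`, and expanding the bracket gives `(N_α - N_{α₀}) L - N_β S L P - S N_β P L + (N_β
N_α + N_{α₀} N_β) L P L`: the products with `s J` vanish because `P J = J P = 0`, and the first
three terms cancel because `L P + P L = L`. This identity, valid for each `ε` without remainder,
is `nfDefect_eq`.

What is left is a sum of products of two operators `N_F`, which is `O(ε)` after composition with
`op^I_ε(a)` on the left. Commuting `z₁` to the left, `N_F N_G` is a sum of terms `z₁² H(εD)`, `ε
z₁ H(εD)` and `ε² H(εD)` (`hasMicroOrder_weylPos_comp`). On the support of `a` one has `z₁ = √ε η`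
with `η` bounded, so that each `z₁` next to `op^I_ε(a)` gains a factor `√ε` (`quant_pos`), up to a
derivative of `a` with coefficient `ε`. The multipliers `H(εD)` are unbounded, but `ξ` is bounded
on the support of `a`, and momenta can be absorbed in `a` (`quant_momentum`,
`HasMicroOrder.fmul`). All this uses only one bound for the operators `op^I_ε(a)`: they are
bounded on `L²` uniformly in `ε`, by Young's inequality, because their kernels are rapidly
decreasing in `(x - y)/ε` (`IsTestSymbol.exists_eLpNorm_quant_le`). -/

open FourierTransform LineDeriv

noncomputable section

/-! ### Multipliers, coordinates and matrices on Schwartz functions -/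

/-- The semiclassical Fourier multiplier `F(εD)` on Schwartz functions, `D = -i∇`. The factor
`2π` comes from the normalization `e^{-2πi k·x}` of the Fourier transform. For `F` not of temperate
growth the value is junk. -/
def fmul (ε : ℝ) (F : R3 → ℂ) : 𝓢(R3, C3) →L[ℂ] 𝓢(R3, C3) :=
  SchwartzMap.fourierMultiplierCLM C3 fun k => F ((2 * Real.pi * ε) • k)

/-- Multiplication by the coordinate `x i`. -/
def pos (i : Fin 3) : 𝓢(R3, C3) →L[ℂ] 𝓢(R3, C3) :=
  SchwartzMap.smulLeftCLM C3 fun x : R3 => ((x i : ℝ) : ℂ)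

/-- A constant matrix acting pointwise on vector-valued Schwartz functions. -/
def matAct (M : Mat3) : 𝓢(R3, C3) →L[ℂ] 𝓢(R3, C3) :=
  SchwartzMap.postcompCLM (Matrix.toEuclideanCLM (n := Fin 3) (𝕜 := ℂ) M)

@[fun_prop]
lemma coord_hasTemperateGrowth (i : Fin 3) :
    (fun x : R3 => ((x i : ℝ) : ℂ)).HasTemperateGrowth :=
  (Complex.ofRealCLM ∘L (EuclideanSpace.proj i : R3 →L[ℝ] ℝ)).hasTemperateGrowth

@[simp]
lemma pos_apply (i : Fin 3) (u : 𝓢(R3, C3)) (x : R3) : pos i u x = ((x i : ℝ) : ℂ) • u x := by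
  simp [pos, SchwartzMap.smulLeftCLM_apply_apply (coord_hasTemperateGrowth i)]

@[simp]
lemma matAct_apply (M : Mat3) (u : 𝓢(R3, C3)) (x : R3) :
    matAct M u x = Matrix.toEuclideanCLM (n := Fin 3) (𝕜 := ℂ) M (u x) := rfl

lemma Function.HasTemperateGrowth.comp_const_smul {F : R3 → ℂ} (hF : F.HasTemperateGrowth) (c : ℝ) :
    (fun k : R3 => F (c • k)).HasTemperateGrowth :=
  hF.comp (c • ContinuousLinearMap.id ℝ R3).hasTemperateGrowth

lemma fourier_fmul (ε : ℝ) {F : R3 → ℂ} (hF : F.HasTemperateGrowth) (u : 𝓢(R3, C3)) (k : R3) :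
    𝓕 (fmul ε F u) k = F ((2 * Real.pi * ε) • k) • 𝓕 u k := by
  rw [fmul, SchwartzMap.fourierMultiplierCLM_apply, fourier_fourierInv_eq,
    SchwartzMap.smulLeftCLM_apply_apply (hF.comp_const_smul _)]

lemma schwartz_ext_fourier {u v : 𝓢(R3, C3)}
    (h : ∀ k, (𝓕 u : 𝓢(R3, C3)) k = (𝓕 v : 𝓢(R3, C3)) k) : u = v := by
  have : (𝓕 u : 𝓢(R3, C3)) = 𝓕 v := by ext1 k; exact h k
  rw [← FourierTransform.fourierInv_fourier_eq (F := 𝓢(R3, C3)) u, this,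
    FourierTransform.fourierInv_fourier_eq]

lemma fmul_fmul (ε : ℝ) {F G : R3 → ℂ} (hF : F.HasTemperateGrowth) (hG : G.HasTemperateGrowth)
    (u : 𝓢(R3, C3)) : fmul ε F (fmul ε G u) = fmul ε (fun ξ => F ξ * G ξ) u := by
  refine schwartz_ext_fourier fun k => ?_
  rw [fourier_fmul ε hF, fourier_fmul ε hG, fourier_fmul ε (F := fun ξ => F ξ * G ξ) (hF.mul hG),
    smul_smul]

lemma fmul_add (ε : ℝ) {F G : R3 → ℂ} (hF : F.HasTemperateGrowth) (hG : G.HasTemperateGrowth)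
    (u : 𝓢(R3, C3)) : fmul ε (fun ξ => F ξ + G ξ) u = fmul ε F u + fmul ε G u := by
  refine schwartz_ext_fourier fun k => ?_
  rw [fourier_fmul ε (F := fun ξ => F ξ + G ξ) (hF.add hG), FourierTransform.fourier_add, add_apply,
    fourier_fmul ε hF, fourier_fmul ε hG, add_smul]

lemma fmul_one (ε : ℝ) (u : 𝓢(R3, C3)) : fmul ε (fun _ => 1) u = u := by
  refine schwartz_ext_fourier fun k => ?_
  rw [fourier_fmul ε (.const 1), one_smul]

lemma fourier_pos (i : Fin 3) (u : 𝓢(R3, C3)) :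
    𝓕 (pos i u) = (Complex.I / (2 * Real.pi)) • ∂_{EuclideanSpace.single i (1 : ℝ)} (𝓕 u) := by
  have h : SchwartzMap.smulLeftCLM C3 (inner ℝ · (EuclideanSpace.single i (1 : ℝ))) u =
      pos i u := by
    ext1 x
    rw [SchwartzMap.smulLeftCLM_apply_apply (by fun_prop), pos_apply]
    simp [EuclideanSpace.inner_single_right]
  rw [SchwartzMap.lineDerivOp_fourier_eq, FourierTransform.fourier_smul, h, smul_smul]
  have : (Complex.I / (2 * Real.pi)) * -(2 * Real.pi * Complex.I) = 1 := by
    have : (Real.pi : ℂ) ≠ 0 := by exact_mod_cast Real.pi_ne_zero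
    field_simp
    simp
  rw [this, one_smul]

lemma fderiv_hasTemperateGrowth {F : R3 → ℂ} (hF : F.HasTemperateGrowth) (v : R3) :
    (fun ξ => fderiv ℝ F ξ v).HasTemperateGrowth := by
  have : (fderiv ℝ F).HasTemperateGrowth := by
    refine ⟨hF.1.fderiv_right (by simp), fun n => ?_⟩
    obtain ⟨k, C, h⟩ := hF.2 (n + 1)
    refine ⟨k, C, fun x => ?_⟩
    rw [norm_iteratedFDeriv_fderiv]
    exact h x
  exact ((ContinuousLinearMap.apply ℝ ℂ v).hasTemperateGrowth).comp this

/-- The commutator of `F(εD)` with a coordinate, `[F(εD), x_i] = -iε (∂_i F)(εD)`. -/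
lemma fmul_pos (ε : ℝ) {F : R3 → ℂ} (hF : F.HasTemperateGrowth) (i : Fin 3) (u : 𝓢(R3, C3)) :
    fmul ε F (pos i u) = pos i (fmul ε F u) -
      (Complex.I * ε) • fmul ε (fun ξ => fderiv ℝ F ξ (EuclideanSpace.single i (1 : ℝ))) u := by
  refine schwartz_ext_fourier fun k => ?_
  rw [fourier_fmul ε hF, sub_eq_add_neg, FourierTransform.fourier_add, add_apply,
    ← neg_smul, FourierTransform.fourier_smul, smul_apply,
    fourier_fmul ε (fderiv_hasTemperateGrowth hF _), fourier_pos, fourier_pos,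
    smul_apply, smul_apply, SchwartzMap.lineDerivOp_apply_eq_fderiv,
    SchwartzMap.lineDerivOp_apply_eq_fderiv]
  have h1 : ((𝓕 (fmul ε F u) : 𝓢(R3, C3)) : R3 → C3) =
      fun k => F ((2 * Real.pi * ε) • k) • 𝓕 u k := by
    ext1 k; exact fourier_fmul ε hF u k
  have hFd : HasFDerivAt (fun k : R3 => F ((2 * Real.pi * ε) • k))
      ((fderiv ℝ F ((2 * Real.pi * ε) • k)) ∘L
        ((2 * Real.pi * ε) • ContinuousLinearMap.id ℝ R3)) k :=
    ((hF.1.differentiable (by simp)) ((2 * Real.pi * ε) • k)).hasFDerivAt.comp k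
      (((2 * Real.pi * ε) • ContinuousLinearMap.id ℝ R3).hasFDerivAt)
  have h2 := (hFd.smul ((𝓕 u : 𝓢(R3, C3)).hasFDerivAt k)).fderiv
  rw [h1, show (fun k => F ((2 * Real.pi * ε) • k) • (𝓕 u : 𝓢(R3, C3)) k) =
    (fun k => F ((2 * Real.pi * ε) • k)) • ⇑(𝓕 u : 𝓢(R3, C3)) from rfl, h2]
  have hpi : (Real.pi : ℂ) ≠ 0 := by exact_mod_cast Real.pi_ne_zero
  simp only [add_apply, smul_apply,
    ContinuousLinearMap.smulRight_apply, ContinuousLinearMap.comp_apply, smul_add, smul_smul,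
    ContinuousLinearMap.id_apply, map_smul, Complex.real_smul]
  rw [add_assoc, ← add_smul]
  have : (Complex.I / (2 * Real.pi)) * (((2 * Real.pi * ε : ℝ) : ℂ) *
      (fderiv ℝ F ((2 * Real.pi * ε) • k)) (EuclideanSpace.single i (1 : ℝ))) +
      -(Complex.I * ε) * (fderiv ℝ F ((2 * Real.pi * ε) • k)) (EuclideanSpace.single i (1 : ℝ)) =
        0 := by
    push_cast
    field_simp
    ring
  rw [this, zero_smul, add_zero, mul_comm]

lemma fourier_matAct (M : Mat3) (u : 𝓢(R3, C3)) : 𝓕 (matAct M u) = matAct M (𝓕 u) := by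
  ext1 k
  rw [matAct_apply, SchwartzMap.fourier_coe, SchwartzMap.fourier_coe, Real.fourier_eq,
    Real.fourier_eq, ← ContinuousLinearMap.integral_comp_comm]
  · simp [Circle.smul_def]
  · exact (Real.fourierIntegral_convergent_iff k).2 u.integrable

lemma fmul_matAct (ε : ℝ) {F : R3 → ℂ} (hF : F.HasTemperateGrowth) (M : Mat3) (u : 𝓢(R3, C3)) :
    fmul ε F (matAct M u) = matAct M (fmul ε F u) := by
  refine schwartz_ext_fourier fun k => ?_
  rw [fourier_fmul ε hF, fourier_matAct, fourier_matAct, matAct_apply, matAct_apply,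
    fourier_fmul ε hF, map_smul]

lemma pos_matAct (i : Fin 3) (M : Mat3) (u : 𝓢(R3, C3)) :
    pos i (matAct M u) = matAct M (pos i u) := by
  ext1 x; simp

lemma matAct_matAct (M N : Mat3) (u : 𝓢(R3, C3)) :
    matAct M (matAct N u) = matAct (M * N) u := by
  ext1 x; simp

/-- A partial derivative as a Fourier multiplier. -/
lemma fmul_coord (ε : ℝ) (i : Fin 3) (u : 𝓢(R3, C3)) :
    fmul ε (fun ξ => ((ξ i : ℝ) : ℂ)) u =
      (ε / Complex.I) • ∂_{EuclideanSpace.single i (1 : ℝ)} u := by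
  refine schwartz_ext_fourier fun k => ?_
  rw [fourier_fmul ε (coord_hasTemperateGrowth i), FourierTransform.fourier_smul,
    SchwartzMap.fourier_lineDerivOp_eq, smul_apply, smul_apply,
    SchwartzMap.smulLeftCLM_apply_apply (by fun_prop), smul_smul]
  simp only [EuclideanSpace.inner_single_right]
  rw [← Complex.coe_smul, smul_smul]
  congr 1
  simp
  field_simp
  simp

/-- Plancherel: a bounded multiplier is bounded on `L²`, uniformly in `ε`. -/
lemma eLpNorm_fmul_le (ε : ℝ) {F : R3 → ℂ} (hF : F.HasTemperateGrowth) {K : ℝ}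
    (hb : ∀ ξ, ‖F ξ‖ ≤ K) (u : 𝓢(R3, C3)) :
    eLpNorm (fmul ε F u) 2 volume ≤ ENNReal.ofReal K * eLpNorm u 2 volume := by
  have key : ∀ v : 𝓢(R3, C3), eLpNorm v 2 volume = eLpNorm (𝓕 v : 𝓢(R3, C3)) 2 volume := by
    intro v
    have h : ‖(𝓕 v : 𝓢(R3, C3)).toLp 2 volume‖ = ‖v.toLp 2 volume‖ :=
      SchwartzMap.norm_fourier_toL2_eq v
    rw [SchwartzMap.norm_toLp, SchwartzMap.norm_toLp] at h
    have h1 : eLpNorm v 2 volume ≠ ⊤ := (v.eLpNorm_lt_top 2 volume).ne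
    have h2 : eLpNorm (𝓕 v : 𝓢(R3, C3)) 2 volume ≠ ⊤ :=
      (SchwartzMap.eLpNorm_lt_top (𝓕 v : 𝓢(R3, C3)) 2 volume).ne
    exact ((ENNReal.toReal_eq_toReal_iff' h2 h1).1 h).symm
  rw [key, key u]
  refine eLpNorm_le_mul_eLpNorm_of_ae_le_mul (Eventually.of_forall fun k => ?_) 2
  rw [fourier_fmul ε hF, norm_smul]
  gcongr
  exact hb _

lemma eLpNorm_matAct_le (M : Mat3) (u : 𝓢(R3, C3)) :
    eLpNorm (matAct M u) 2 volume ≤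
      ENNReal.ofReal ‖Matrix.toEuclideanCLM (n := Fin 3) (𝕜 := ℂ) M‖ * eLpNorm u 2 volume :=
  eLpNorm_le_mul_eLpNorm_of_ae_le_mul
    (Eventually.of_forall fun _ => ContinuousLinearMap.le_opNorm _ _) 2

/-! ### Two-microlocal operators with test symbols -/

/-- Smooth compactly supported operator-valued functions of `(x, ξ, η)`. -/
def IsTestSymbol (A : R3 × R3 × ℝ → C3 →L[ℂ] C3) : Prop :=
  ContDiff ℝ ∞ A ∧ HasCompactSupport A

namespace IsTestSymbol

variable {A : R3 × R3 × ℝ → C3 →L[ℂ] C3}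

lemma smul (hA : IsTestSymbol A) {f : R3 × R3 × ℝ → ℝ} (hf : ContDiff ℝ ∞ f) :
    IsTestSymbol fun p => f p • A p := by
  refine ⟨hf.smul hA.1, hA.2.mono fun p h h0 => h ?_⟩
  change f p • A p = 0
  rw [show A p = 0 from h0]
  ext1 v
  rw [smul_apply]
  simp

lemma fderiv_apply (hA : IsTestSymbol A) (w : R3 × R3 × ℝ) :
    IsTestSymbol fun p => fderiv ℝ A p w :=
  ⟨(hA.1.fderiv_right (by simp)).clm_apply contDiff_const,
    hA.2.fderiv_apply ℝ w⟩

end IsTestSymbol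

/-- The semiclassical phase `e^{(i/ε) ξ·(x - y)}` as a function of `q = (ξ, y)`. -/
def phase (ε : ℝ) (x : R3) (q : R3 × R3) : ℂ :=
  Complex.exp (Complex.I / (ε : ℂ) * (inner ℝ q.1 (x - q.2) : ℝ))

/-- The point `((x + y)/2, ξ, (x₁ + y₁)/(2√ε))` at which the amplitude of a two-microlocal operator
is evaluated, as a function of `q = (ξ, y)`. -/
def midPoint (ε : ℝ) (x : R3) (q : R3 × R3) : R3 × R3 × ℝ :=
  ((2 : ℝ)⁻¹ • (x + q.2), q.1, ((2 : ℝ)⁻¹ • (x + q.2)) 1 / √ε)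

/-- The two-microlocal quantization `opI`, for symbols with values in the continuous linear
endomorphisms of `ℂ³` instead of matrices. -/
def quant (ε : ℝ) (A : R3 × R3 × ℝ → C3 →L[ℂ] C3) (u : R3 → C3) (x : R3) : C3 :=
  (((2 * Real.pi * ε) ^ 3)⁻¹ : ℝ) •
    ∫ ξ : R3, ∫ y : R3, phase ε x (ξ, y) • A (midPoint ε x (ξ, y)) (u y)

lemma opI_eq_quant (ε : ℝ) (a : R3 × R3 × ℝ → Mat3) (u : R3 → C3) :
    opI ε a u = quant ε (fun p => Matrix.toEuclideanCLM (n := Fin 3) (𝕜 := ℂ) (a p)) u := rfl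

lemma norm_phase (ε : ℝ) (x : R3) (q : R3 × R3) : ‖phase ε x q‖ = 1 := by
  rw [phase, show Complex.I / (ε : ℂ) * (inner ℝ q.1 (x - q.2) : ℝ) =
    ((inner ℝ q.1 (x - q.2) / ε : ℝ) : ℂ) * Complex.I by push_cast; ring,
    Complex.norm_exp_ofReal_mul_I]

lemma contDiff_phase (ε : ℝ) (x : R3) : ContDiff ℝ ∞ (phase ε x) := by
  unfold phase
  refine ContDiff.cexp (contDiff_const.mul (Complex.ofRealCLM.contDiff.comp ?_))
  exact contDiff_fst.inner ℝ (contDiff_const.sub contDiff_snd)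

lemma continuous_phase (ε : ℝ) : Continuous fun r : R3 × R3 × R3 => phase ε r.1 r.2 := by
  unfold phase
  fun_prop

lemma continuous_midPoint (ε : ℝ) : Continuous fun r : R3 × R3 × R3 => midPoint ε r.1 r.2 := by
  unfold midPoint
  fun_prop

/-- The derivative of `midPoint ε x`. -/
def midPointDeriv (ε : ℝ) : R3 × R3 →L[ℝ] R3 × R3 × ℝ :=
  ((2 : ℝ)⁻¹ • ContinuousLinearMap.snd ℝ R3 R3).prod
    ((ContinuousLinearMap.fst ℝ R3 R3).prod
      ((2 * √ε)⁻¹ • (EuclideanSpace.proj 1 : R3 →L[ℝ] ℝ) ∘L ContinuousLinearMap.snd ℝ R3 R3))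

lemma midPoint_eq (ε : ℝ) (x : R3) (q : R3 × R3) :
    midPoint ε x q = midPoint ε x 0 + midPointDeriv ε q := by
  simp only [midPoint, midPointDeriv, ContinuousLinearMap.prod_apply, smul_apply,
    ContinuousLinearMap.coe_snd', ContinuousLinearMap.coe_fst', ContinuousLinearMap.comp_apply,
    Prod.mk_add_mk, Prod.fst_zero, Prod.snd_zero, add_zero, zero_add, smul_add, Prod.mk.injEq,
    true_and]
  simp
  ring

lemma hasFDerivAt_midPoint (ε : ℝ) (x : R3) (q : R3 × R3) :
    HasFDerivAt (midPoint ε x) (midPointDeriv ε) q := by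
  rw [show midPoint ε x = fun q => midPoint ε x 0 + midPointDeriv ε q from
    funext (midPoint_eq ε x)]
  exact (midPointDeriv ε).hasFDerivAt.const_add _

lemma fderiv_phase_apply (ε : ℝ) (x : R3) (q v : R3 × R3) :
    fderiv ℝ (phase ε x) q v =
      (Complex.I / ε * ((inner ℝ v.1 (x - q.2) - inner ℝ q.1 v.2 : ℝ) : ℂ)) * phase ε x q := by
  have h1 : HasFDerivAt (fun q : R3 × R3 => x - q.2) (-ContinuousLinearMap.snd ℝ R3 R3) q :=
    (ContinuousLinearMap.snd ℝ R3 R3).hasFDerivAt.const_sub x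
  have h2 := (ContinuousLinearMap.fst ℝ R3 R3).hasFDerivAt (x := q) |>.inner ℝ h1
  have h3 := ((Complex.ofRealCLM.hasFDerivAt.comp q h2).const_mul (Complex.I / (ε : ℂ))).cexp
  rw [show phase ε x = fun q => Complex.exp (Complex.I / (ε : ℂ) *
    ((Complex.ofRealCLM ∘ fun q : R3 × R3 => (inner ℝ (ContinuousLinearMap.fst ℝ R3 R3 q)
      (x - q.2) : ℝ)) q)) from rfl]
  rw [h3.fderiv]
  simp [fderivInnerCLM_apply]
  ring

lemma hasCompactSupport_comp_midPoint {A : R3 × R3 × ℝ → C3 →L[ℂ] C3} (hA : IsTestSymbol A)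
    (ε : ℝ) (x : R3) : HasCompactSupport fun q => A (midPoint ε x q) := by
  refine HasCompactSupport.intro (K := (fun p : R3 × R3 × ℝ => (p.2.1, (2 : ℝ) • p.1 - x)) ''
    tsupport A) (hA.2.isCompact.image (by fun_prop)) fun q hq => ?_
  refine image_eq_zero_of_notMem_tsupport fun h => hq ⟨_, h, ?_⟩
  simp [midPoint]

lemma integrable_quant {A : R3 × R3 × ℝ → C3 →L[ℂ] C3} (hA : IsTestSymbol A)
    {f : R3 × R3 → ℂ} (hf : Continuous f) (ε : ℝ) {u : R3 → C3} (hu : Continuous u) (x : R3) :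
    Integrable fun q : R3 × R3 => f q • A (midPoint ε x q) (u q.2) := by
  have hm : Continuous (midPoint ε x) :=
    (continuous_midPoint ε).comp (f := fun q => (x, q)) (by fun_prop)
  refine Continuous.integrable_of_hasCompactSupport ?_ ?_
  · exact hf.smul ((hA.1.continuous.comp hm).clm_apply (hu.comp continuous_snd))
  · refine (hasCompactSupport_comp_midPoint hA ε x).mono fun q hq h => hq ?_
    simp only at h
    simp [h]

lemma continuous_phase_right (ε : ℝ) (x : R3) : Continuous (phase ε x) :=
  (contDiff_phase ε x).continuous

lemma quant_eq {A : R3 × R3 × ℝ → C3 →L[ℂ] C3} (hA : IsTestSymbol A) (ε : ℝ) {u : R3 → C3}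
    (hu : Continuous u) (x : R3) :
    quant ε A u x = (((2 * Real.pi * ε) ^ 3)⁻¹ : ℝ) •
      ∫ q : R3 × R3, phase ε x q • A (midPoint ε x q) (u q.2) := by
  rw [quant, Measure.volume_eq_prod, integral_prod]
  rw [← Measure.volume_eq_prod]
  exact integrable_quant hA (continuous_phase_right ε x) ε hu x

lemma quant_add {A : R3 × R3 × ℝ → C3 →L[ℂ] C3} (hA : IsTestSymbol A) (ε : ℝ) {u v : R3 → C3}
    (hu : Continuous u) (hv : Continuous v) :
    quant ε A (u + v) = quant ε A u + quant ε A v := by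
  ext1 x
  rw [Pi.add_apply, quant_eq hA ε hu, quant_eq hA ε hv, quant_eq hA ε (hu.add hv), ← smul_add,
    ← integral_add (integrable_quant hA (continuous_phase_right ε x) ε hu x)
      (integrable_quant hA (continuous_phase_right ε x) ε hv x)]
  simp

lemma quant_smul (A : R3 × R3 × ℝ → C3 →L[ℂ] C3) (ε : ℝ) (c : ℂ) (u : R3 → C3) :
    quant ε A (c • u) = c • quant ε A u := by
  ext1 x
  simp only [quant, Pi.smul_apply, map_smul]
  rw [smul_comm c]
  simp_rw [← integral_smul, smul_comm c]

/-- Integration by parts in the oscillatory integral over `(ξ, y)`. -/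
lemma quant_integral_by_parts {A : R3 × R3 × ℝ → C3 →L[ℂ] C3} (hA : IsTestSymbol A) (ε : ℝ)
    (u : 𝓢(R3, C3)) (x : R3) (v : R3 × R3) :
    (∫ q : R3 × R3, phase ε x q • fderiv ℝ A (midPoint ε x q) (midPointDeriv ε v) (u q.2)) +
      (∫ q : R3 × R3, phase ε x q • A (midPoint ε x q) ((∂_{v.2} u : 𝓢(R3, C3)) q.2)) =
    -∫ q : R3 × R3, ((Complex.I / ε * ((inner ℝ v.1 (x - q.2) - inner ℝ q.1 v.2 : ℝ) : ℂ)) *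
      phase ε x q) • A (midPoint ε x q) (u q.2) := by
  have hp := continuous_phase_right ε x
  have hI1 := integrable_quant (hA.fderiv_apply (midPointDeriv ε v)) hp ε u.continuous x
  have hI2 := integrable_quant hA hp ε (∂_{v.2} u : 𝓢(R3, C3)).continuous x
  have h1 : ∀ q : R3 × R3, HasFDerivAt
      (fun q => (A (midPoint ε x q)).restrictScalars ℝ) _ q := fun q =>
    (ContinuousLinearMap.restrictScalarsL ℂ C3 C3 ℝ ℝ).hasFDerivAt.comp q
      ((hA.1.differentiable (by simp) (midPoint ε x q)).hasFDerivAt.comp q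
        (hasFDerivAt_midPoint ε x q))
  have h2 : ∀ q : R3 × R3, HasFDerivAt (fun q : R3 × R3 => u q.2) _ q := fun q =>
    (u.hasFDerivAt q.2).comp q (hasFDerivAt_snd (𝕜 := ℝ))
  have hd : ∀ q : R3 × R3, HasFDerivAt (fun q : R3 × R3 => A (midPoint ε x q) (u q.2)) _ q :=
    fun q => (h1 q).clm_apply (h2 q)
  have hdv : ∀ q : R3 × R3, fderiv ℝ (fun q : R3 × R3 => A (midPoint ε x q) (u q.2)) q v =
      fderiv ℝ A (midPoint ε x q) (midPointDeriv ε v) (u q.2) +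
        A (midPoint ε x q) ((∂_{v.2} u : 𝓢(R3, C3)) q.2) := by
    intro q
    rw [(hd q).fderiv, SchwartzMap.lineDerivOp_apply_eq_fderiv]
    simp [add_comm]
  have : (volume : Measure (R3 × R3)).IsAddHaarMeasure := by
    rw [Measure.volume_eq_prod]; infer_instance
  rw [← integral_add hI1 hI2]
  simp_rw [← smul_add, ← hdv, ← fderiv_phase_apply]
  refine integral_smul_fderiv_eq_neg_fderiv_smul_of_integrable ?_ ?_ ?_ ?_ ?_
  · simp_rw [fderiv_phase_apply]
    exact integrable_quant hA (by fun_prop) ε u.continuous x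
  · simp_rw [hdv, smul_add]
    exact hI1.add hI2
  · exact integrable_quant hA hp ε u.continuous x
  · exact fun q _ => (contDiff_phase ε x).differentiable (by simp) q
  · exact fun q _ => (hd q).differentiableAt

/-- Exchange of a two-microlocal operator with the coordinate `z₁`, which costs `√ε`: on the
support of the symbol `z₁ = √ε η` with `η` bounded. -/
lemma quant_pos {A : R3 × R3 × ℝ → C3 →L[ℂ] C3} (hA : IsTestSymbol A) {ε : ℝ} (hε : 0 < ε)
    (u : 𝓢(R3, C3)) :
    quant ε A (pos 1 u) = ((√ε : ℝ) : ℂ) • quant ε (fun p => p.2.2 • A p) u -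
      (Complex.I * ε / 2) •
        quant ε (fun p => fderiv ℝ A p (0, EuclideanSpace.single 1 1, 0)) u := by
  ext1 x
  have hp := continuous_phase_right ε x
  have hη : IsTestSymbol fun p : R3 × R3 × ℝ => p.2.2 • A p := hA.smul (by fun_prop)
  have hd := hA.fderiv_apply (0, EuclideanSpace.single 1 1, 0)
  rw [Pi.sub_apply, Pi.smul_apply, Pi.smul_apply, quant_eq hA ε (SchwartzMap.continuous _),
    quant_eq hη ε u.continuous, quant_eq hd ε u.continuous, smul_comm (_ : ℂ) (_ : ℝ),
    smul_comm (Complex.I * ε / 2 : ℂ) (_ : ℝ), ← smul_sub]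
  congr 1
  have hibp := quant_integral_by_parts hA ε u x (EuclideanSpace.single 1 1, 0)
  have hm : midPointDeriv ε (EuclideanSpace.single 1 1, 0) =
      (0, EuclideanSpace.single 1 1, 0) := by simp [midPointDeriv]
  have hz : (∂_{(0 : R3)} u : 𝓢(R3, C3)) = 0 := by
    ext1 y; rw [SchwartzMap.lineDerivOp_apply_eq_fderiv]; simp
  rw [hm] at hibp
  simp only [hz, zero_apply, map_zero, smul_zero, integral_zero, add_zero] at hibp
  rw [hibp, smul_neg, sub_neg_eq_add, ← integral_smul, ← integral_smul, ← integral_add]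
  · congr 1
    ext1 q
    have hs : ((√ε : ℝ) : ℂ) ≠ 0 := by exact_mod_cast (Real.sqrt_pos.2 hε).ne'
    have he : (ε : ℂ) ≠ 0 := by exact_mod_cast hε.ne'
    rw [pos_apply, map_smul, smul_apply, ← Complex.coe_smul, smul_smul,
      smul_smul, smul_smul, smul_smul, ← add_smul]
    congr 1
    simp [midPoint, EuclideanSpace.inner_single_left]
    field_simp
    simp
    ring
  · exact (integrable_quant hη hp ε u.continuous x).smul ((√ε : ℝ) : ℂ)
  · exact (integrable_quant hA (f := fun q => Complex.I / ε * ((inner ℝ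
      (EuclideanSpace.single 1 1) (x - q.2) - inner ℝ q.1 0 : ℝ) : ℂ) * phase ε x q)
      (by fun_prop) ε u.continuous x).smul (Complex.I * ε / 2)

/-- Exchange of a two-microlocal operator with a momentum `εD_j`, which costs nothing: the
derivative of the symbol in `z₁` is only of size `1/√ε`. -/
lemma quant_momentum {A : R3 × R3 × ℝ → C3 →L[ℂ] C3} (hA : IsTestSymbol A) {ε : ℝ} (hε : 0 < ε)
    (j : Fin 3) (u : 𝓢(R3, C3)) :
    quant ε A (fmul ε (fun ξ => ((ξ j : ℝ) : ℂ)) u) =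
      quant ε (fun p => p.2.1 j • A p) u + (Complex.I * ε / 2) •
        quant ε (fun p => fderiv ℝ A p (EuclideanSpace.single j 1, 0, 0)) u +
      (Complex.I * √ε * ((EuclideanSpace.single j (1 : ℝ) : R3) 1 : ℝ) / 2) •
        quant ε (fun p => fderiv ℝ A p (0, 0, 1)) u := by
  ext1 x
  have hp := continuous_phase_right ε x
  have hξ : IsTestSymbol fun p : R3 × R3 × ℝ => p.2.1 j • A p := hA.smul (by fun_prop)
  have hd := hA.fderiv_apply (EuclideanSpace.single j 1, 0, 0)
  have hd' := hA.fderiv_apply (0, 0, 1)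
  have iξ := integrable_quant hξ hp ε u.continuous x
  have id := integrable_quant hd hp ε u.continuous x
  have id' := integrable_quant hd' hp ε u.continuous x
  have iA := integrable_quant hA (f := fun q => Complex.I / ε * ((inner ℝ
    0 (x - q.2) - inner ℝ q.1 (EuclideanSpace.single j 1) : ℝ) : ℂ) * phase ε x q)
    (by fun_prop) ε u.continuous x
  rw [fmul_coord, Pi.add_apply, Pi.add_apply, Pi.smul_apply, Pi.smul_apply,
    quant_eq hA ε (SchwartzMap.continuous _),
    quant_eq hξ ε u.continuous, quant_eq hd ε u.continuous, quant_eq hd' ε u.continuous,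
    smul_comm (Complex.I * ε / 2 : ℂ) (_ : ℝ), smul_comm (_ : ℂ) (_ : ℝ),
    ← smul_add, ← smul_add]
  congr 1
  have hibp := quant_integral_by_parts hA ε u x (0, EuclideanSpace.single j 1)
  have hm : midPointDeriv ε (0, EuclideanSpace.single j 1) =
      (2 : ℝ)⁻¹ • (EuclideanSpace.single j 1, 0, 0) +
        ((2 * √ε)⁻¹ * (EuclideanSpace.single j (1 : ℝ) : R3) 1) • (0, 0, 1) := by
    simp only [midPointDeriv]
    ext <;> simp <;> split_ifs <;> simp
  have hs : ((√ε : ℝ) : ℂ) ≠ 0 := by exact_mod_cast (Real.sqrt_pos.2 hε).ne'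
  have he : (ε : ℂ) ≠ 0 := by exact_mod_cast hε.ne'
  have hss : ((√ε : ℝ) : ℂ) * (√ε : ℝ) = ε := by exact_mod_cast Real.mul_self_sqrt hε.le
  simp only [hm, map_add, map_smul, add_apply, smul_apply, smul_add] at hibp
  rw [← eq_sub_iff_add_eq'] at hibp
  simp only [smul_apply, map_smul]
  simp_rw [smul_comm _ (ε / Complex.I : ℂ)]
  rw [integral_smul, hibp, smul_sub, ← integral_neg, ← integral_smul, ← integral_smul,
    ← integral_smul, ← integral_smul,
    ← integral_sub, ← integral_add, ← integral_add]
  · congr 1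
    ext1 q
    simp only [← Complex.coe_smul, smul_smul, ← neg_smul, smul_add, sub_eq_add_neg, neg_add,
      ← add_assoc]
    congr 1
    · congr 1
      · congr 1
        simp [midPoint, EuclideanSpace.inner_single_right]
        field_simp
        simp
      · congr 1
        push_cast
        field_simp
        simp
    · congr 1
      push_cast
      rw [← hss]
      field_simp
      simp
  · exact (iξ.add (id.smul (Complex.I * ε / 2)))
  · exact id'.smul (Complex.I * √ε * ((EuclideanSpace.single j (1 : ℝ) : R3) 1 : ℝ) / 2)
  · exact iξ
  · exact id.smul (Complex.I * ε / 2)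
  · exact (iA.neg).smul (ε / Complex.I : ℂ)
  · refine Integrable.smul (ε / Complex.I : ℂ) (Integrable.add ?_ ?_)
    · refine (id.smul (2⁻¹ : ℝ)).congr (Eventually.of_forall fun q => ?_)
      exact smul_comm (2⁻¹ : ℝ) (phase ε x q) _
    · refine (id'.smul ((2 * √ε)⁻¹ * (EuclideanSpace.single j (1 : ℝ) : R3) 1 : ℝ)).congr
        (Eventually.of_forall fun q => ?_)
      exact smul_comm (_ : ℝ) (phase ε x q) _

/-! ### Uniform boundedness on `L²` -/

/-- Young's inequality `‖k * g‖₂ ≤ ‖k‖₁ ‖g‖₂` for nonnegative functions. -/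
lemma lintegral_sq_lintegral_mul_sub_le {k g : R3 → ENNReal} (hk : Measurable k)
    (hg : Measurable g) :
    ∫⁻ x, (∫⁻ y, k (x - y) * g y) ^ 2 ≤ (∫⁻ z, k z) ^ 2 * ∫⁻ y, g y ^ 2 := by
  have hkx : ∀ x, ∫⁻ y, k (x - y) = ∫⁻ z, k z := fun x => lintegral_sub_left_eq_self k x
  have cs : ∀ x, (∫⁻ y, k (x - y) * g y) ^ 2 ≤ (∫⁻ z, k z) * ∫⁻ y, k (x - y) * g y ^ 2 := by
    intro x
    have hm : Measurable fun y => k (x - y) := hk.comp (measurable_const.sub measurable_id)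
    have h := ENNReal.lintegral_mul_le_Lp_mul_Lq volume Real.HolderConjugate.two_two
      (f := fun y => k (x - y) ^ (1 / 2 : ℝ)) (g := fun y => k (x - y) ^ (1 / 2 : ℝ) * g y)
      (hm.pow_const _).aemeasurable ((hm.pow_const _).mul hg).aemeasurable
    have hsq : ∀ a : ENNReal, (a ^ (1 / 2 : ℝ)) ^ (2 : ℝ) = a := fun a => by
      rw [← ENNReal.rpow_mul]; norm_num
    have hss : ∀ a : ENNReal, a ^ (1 / 2 : ℝ) * a ^ (1 / 2 : ℝ) = a := fun a => by
      rw [← ENNReal.rpow_add_of_nonneg _ _ (by norm_num) (by norm_num)]; norm_num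
    simp only [Pi.mul_apply, ← mul_assoc, hss] at h
    simp only [ENNReal.mul_rpow_of_nonneg _ _ (zero_le_two : (0 : ℝ) ≤ 2), hsq] at h
    have h2 := ENNReal.rpow_le_rpow h (zero_le_two : (0 : ℝ) ≤ 2)
    rw [ENNReal.mul_rpow_of_nonneg _ _ (zero_le_two : (0 : ℝ) ≤ 2), hsq, hsq, hkx] at h2
    simpa only [ENNReal.rpow_two] using h2
  have hm2 : Measurable fun r : R3 × R3 => k (r.1 - r.2) * g r.2 ^ 2 :=
    (hk.comp (measurable_fst.sub measurable_snd)).mul ((hg.comp measurable_snd).pow_const 2)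
  calc ∫⁻ x, (∫⁻ y, k (x - y) * g y) ^ 2
      ≤ ∫⁻ x, (∫⁻ z, k z) * ∫⁻ y, k (x - y) * g y ^ 2 := lintegral_mono cs
    _ = (∫⁻ z, k z) * ∫⁻ x, ∫⁻ y, k (x - y) * g y ^ 2 :=
        lintegral_const_mul _ hm2.lintegral_prod_right'
    _ = (∫⁻ z, k z) * ∫⁻ y, ∫⁻ x, k (x - y) * g y ^ 2 := by
        rw [lintegral_lintegral_swap hm2.aemeasurable]
    _ = (∫⁻ z, k z) * ∫⁻ y, (∫⁻ z, k z) * g y ^ 2 := by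
        congr 2; ext1 y
        rw [lintegral_mul_const (f := fun x => k (x - y)) _ (hk.comp (measurable_id.sub_const y)),
          lintegral_sub_right_eq_self k y]
    _ = (∫⁻ z, k z) ^ 2 * ∫⁻ y, g y ^ 2 := by
        rw [lintegral_const_mul _ (hg.pow_const 2), ← mul_assoc, sq]

/-- A function dominated by a convolution `k * ‖u‖` satisfies `‖f‖₂ ≤ ‖k‖₁ ‖u‖₂`. -/
lemma eLpNorm_two_le_of_le_convolution {f u : R3 → C3} {k : R3 → ENNReal} (hk : Measurable k)
    (hu : Continuous u) (h : ∀ x, ‖f x‖ₑ ≤ ∫⁻ y, k (x - y) * ‖u y‖ₑ) :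
    eLpNorm f 2 volume ≤ (∫⁻ z, k z) * eLpNorm u 2 volume := by
  have h2 : ∀ v : R3 → C3, eLpNorm v 2 volume = (∫⁻ x, ‖v x‖ₑ ^ 2) ^ (1 / 2 : ℝ) := fun v => by
    rw [eLpNorm_eq_lintegral_rpow_enorm_toReal (by norm_num) (by norm_num)]
    simp
  have key : ∫⁻ x, ‖f x‖ₑ ^ 2 ≤ (∫⁻ z, k z) ^ 2 * ∫⁻ y, ‖u y‖ₑ ^ 2 :=
    (lintegral_mono fun x => pow_le_pow_left' (h x) 2).trans
      (lintegral_sq_lintegral_mul_sub_le hk hu.enorm.measurable)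
  rw [h2, h2]
  refine (ENNReal.rpow_le_rpow key (by norm_num)).trans_eq ?_
  rw [ENNReal.mul_rpow_of_nonneg _ _ (by norm_num), ← ENNReal.rpow_natCast_mul]
  norm_num

/-- The partial Fourier transform in `ξ` of a test symbol decays rapidly, uniformly in the other
variables. The exponent `4` is the least integer that makes the bound integrable on `ℝ³`. -/
lemma IsTestSymbol.exists_fourier_bound {A : R3 × R3 × ℝ → C3 →L[ℂ] C3} (hA : IsTestSymbol A) :
    ∃ K : ℝ, 0 ≤ K ∧ ∀ (p : R3) (η : ℝ) (w : R3),
      ‖∫ ξ : R3, Complex.exp ((inner ℝ ξ w : ℝ) * Complex.I) • A (p, ξ, η)‖ ≤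
        K * (1 + ‖w‖) ^ (-4 : ℝ) := by
  -- the derivatives of the slices are bounded by those of `A`
  have hslice : ∀ (j : ℕ) (p : R3) (η : ℝ) (ξ : R3),
      ‖iteratedFDeriv ℝ j (fun ξ => A (p, ξ, η)) ξ‖ ≤ ‖iteratedFDeriv ℝ j A (p, ξ, η)‖ := by
    intro j p η ξ
    set ι : R3 →L[ℝ] R3 × R3 × ℝ :=
      (ContinuousLinearMap.inr ℝ R3 (R3 × ℝ)) ∘L (ContinuousLinearMap.inl ℝ R3 ℝ) with hι
    have e : (fun ξ => A (p, ξ, η)) = (fun r => A ((p, 0, η) + r)) ∘ ι := by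
      ext1 ξ; simp [hι]
    have hs : ContDiff ℝ ∞ fun r => A ((p, 0, η) + r) := hA.1.comp (contDiff_const.add contDiff_id)
    rw [e, ι.iteratedFDeriv_comp_right hs ξ (mod_cast le_top), iteratedFDeriv_comp_add_left]
    have hle : ‖ι‖ ≤ 1 := by
      refine ContinuousLinearMap.opNorm_le_bound _ zero_le_one fun v => ?_
      simp [hι, Prod.norm_def]
    have hp : (p, 0, η) + ι ξ = (p, ξ, η) := by simp [hι]
    rw [hp]
    refine (ContinuousMultilinearMap.norm_compContinuousLinearMap_le _ _).trans ?_
    refine mul_le_of_le_one_right (norm_nonneg _) ?_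
    exact Finset.prod_le_one (fun _ _ => norm_nonneg _) fun _ _ => hle
  have hKc : IsCompact ((fun r : R3 × R3 × ℝ => r.2.1) '' tsupport A) :=
    hA.2.isCompact.image (by fun_prop)
  set S := (fun r : R3 × R3 × ℝ => r.2.1) '' tsupport A with hS
  have hzero : ∀ (j : ℕ) (p : R3) (η : ℝ) (ξ : R3), ξ ∉ S →
      iteratedFDeriv ℝ j A (p, ξ, η) = 0 := by
    intro j p η ξ hξ
    refine image_eq_zero_of_notMem_tsupport fun h => hξ ⟨_, tsupport_iteratedFDeriv_subset j h, rfl⟩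
  have hbd : ∀ j : ℕ, ∃ M : ℝ, ∀ r, ‖iteratedFDeriv ℝ j A r‖ ≤ M := fun j =>
    (hA.2.iteratedFDeriv j).exists_bound_of_continuous
      (hA.1.continuous_iteratedFDeriv (mod_cast le_top))
  choose M hM using hbd
  have hM0 : ∀ j, 0 ≤ M j := fun j => (norm_nonneg _).trans (hM j 0)
  have hdom : ∀ (j : ℕ) (p : R3) (η : ℝ) (ξ : R3),
      ‖iteratedFDeriv ℝ j (fun ξ => A (p, ξ, η)) ξ‖ ≤ S.indicator (fun _ => M j) ξ := by
    intro j p η ξ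
    refine (hslice j p η ξ).trans ?_
    by_cases hξ : ξ ∈ S
    · simpa [hξ] using hM j _
    · simp [hξ, hzero j p η ξ hξ]
  have hind : ∀ j, Integrable (S.indicator fun _ : R3 => M j) := fun j =>
    (integrable_indicator_iff hKc.isClosed.measurableSet).2
      (integrableOn_const hKc.measure_lt_top.ne)
  have hsm : ∀ (p : R3) (η : ℝ), ContDiff ℝ ∞ fun ξ => A (p, ξ, η) := fun p η =>
    hA.1.comp (contDiff_const.prodMk (contDiff_id.prodMk contDiff_const))
  have hint : ∀ (j : ℕ) (p : R3) (η : ℝ),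
      Integrable fun ξ => ‖iteratedFDeriv ℝ j (fun ξ => A (p, ξ, η)) ξ‖ := fun j p η =>
    (hind j).mono' ((hsm p η).continuous_iteratedFDeriv (mod_cast le_top)).norm.aestronglyMeasurable
      (Eventually.of_forall fun ξ => by rw [norm_norm]; exact hdom j p η ξ)
  set D : ℕ → ℝ := fun j => ∫ ξ, S.indicator (fun _ : R3 => M j) ξ with hD
  have hD0 : ∀ j, 0 ≤ D j := fun j => integral_nonneg fun ξ =>
    Set.indicator_nonneg (fun _ _ => hM0 j) ξ
  -- `n` integrations by parts; the cases `n = 0` and `n = 4` give the claim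
  have hdecay : ∀ (n : ℕ), n ≤ 4 → ∀ (p : R3) (η : ℝ) (w : R3),
      ‖w‖ ^ n * ‖𝓕 (fun ξ => A (p, ξ, η)) w‖ ≤ 2 ^ n * ∑ j ∈ Finset.range (n + 1), D j := by
    intro n hn p η w
    have h := Real.pow_mul_norm_iteratedFDeriv_fourier_le (K := 0) (N := 4)
      ((hsm p η).of_le (mod_cast le_top)) (fun k m hk hm => by
        have : k = 0 := by simpa using hk
        subst this
        simpa using hint m p η) (k := 0) (n := n) le_rfl (by exact_mod_cast hn) w
    simp only [norm_iteratedFDeriv_zero] at h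
    refine h.trans ?_
    simp only [pow_zero, one_mul, Nat.cast_zero, mul_zero, zero_add, Finset.range_one,
      Finset.singleton_product, Finset.sum_map, Function.Embedding.coeFn_mk]
    gcongr with j hj
    exact integral_mono (hint j p η) (hind j) (hdom j p η)
  refine ⟨8 * (2 * Real.pi) ^ 4 * (D 0 + 2 ^ 4 * ∑ j ∈ Finset.range 5, D j),
    by have := Finset.sum_nonneg fun j (_ : j ∈ Finset.range 5) => hD0 j; have := hD0 0; positivity,
    fun p η w => ?_⟩
  set v : R3 := -((2 * Real.pi)⁻¹ • w) with hv
  have hF : ∫ ξ : R3, Complex.exp ((inner ℝ ξ w : ℝ) * Complex.I) • A (p, ξ, η) =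
      𝓕 (fun ξ => A (p, ξ, η)) v := by
    rw [Real.fourier_eq']
    congr 1; ext1 ξ
    congr 3
    rw [hv, inner_neg_right, real_inner_smul_right]
    field_simp
  rw [hF]
  set N := ‖𝓕 (fun ξ => A (p, ξ, η)) v‖ with hN
  have h0 := hdecay 0 (by norm_num) p η v
  have h4 := hdecay 4 le_rfl p η v
  rw [← hN] at h0 h4
  simp only [pow_zero, one_mul, zero_add, Finset.range_one, Finset.sum_singleton] at h0
  have hw : ‖w‖ = 2 * Real.pi * ‖v‖ := by
    rw [hv, norm_neg, norm_smul, Real.norm_of_nonneg (by positivity)]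
    field_simp
  have hpos : 0 < 1 + ‖w‖ := by positivity
  rw [Real.rpow_neg hpos.le, ← div_eq_mul_inv, le_div_iff₀ (by positivity)]
  rw [show (4 : ℝ) = ((4 : ℕ) : ℝ) by norm_num, Real.rpow_natCast]
  have hpi : 1 ≤ 2 * Real.pi := by linarith [Real.pi_gt_three]
  have hb : (1 + ‖w‖) ^ 4 ≤ (2 * Real.pi) ^ 4 * (8 * (1 + ‖v‖ ^ 4)) := by
    have : 1 + ‖w‖ ≤ 2 * Real.pi * (1 + ‖v‖) := by rw [hw]; linarith
    refine (pow_le_pow_left₀ hpos.le this 4).trans ?_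
    rw [mul_pow]
    gcongr
    have := add_pow_le zero_le_one (norm_nonneg v) 4
    norm_num at this
    linarith
  have hN0 : 0 ≤ N := norm_nonneg _
  calc N * (1 + ‖w‖) ^ 4 ≤ N * ((2 * Real.pi) ^ 4 * (8 * (1 + ‖v‖ ^ 4))) := by gcongr
    _ = 8 * (2 * Real.pi) ^ 4 * (N + ‖v‖ ^ 4 * N) := by ring
    _ ≤ _ := by
      gcongr

lemma phase_eq (ε : ℝ) (x : R3) (q : R3 × R3) :
    phase ε x q = Complex.exp ((inner ℝ q.1 (ε⁻¹ • (x - q.2)) : ℝ) * Complex.I) := by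
  rw [phase, real_inner_smul_right]
  push_cast
  congr 1
  ring

/-- The kernel of a two-microlocal operator with a test symbol is rapidly decreasing in
`(x - y)/ε`. -/
lemma IsTestSymbol.norm_integral_phase_le {A : R3 × R3 × ℝ → C3 →L[ℂ] C3} (hA : IsTestSymbol A)
    {K : ℝ} (hK : ∀ (p : R3) (η : ℝ) (w : R3),
      ‖∫ ξ : R3, Complex.exp ((inner ℝ ξ w : ℝ) * Complex.I) • A (p, ξ, η)‖ ≤
        K * (1 + ‖w‖) ^ (-4 : ℝ)) (ε : ℝ) (x y : R3) (v : C3) :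
    ‖∫ ξ : R3, phase ε x (ξ, y) • A (midPoint ε x (ξ, y)) v‖ ≤
      K * (1 + ‖ε⁻¹ • (x - y)‖) ^ (-4 : ℝ) * ‖v‖ := by
  have hm : Continuous (midPoint ε x) :=
    (continuous_midPoint ε).comp (f := fun q => (x, q)) (by fun_prop)
  have hiA : Integrable fun ξ : R3 => phase ε x (ξ, y) • A (midPoint ε x (ξ, y)) := by
    refine Continuous.integrable_of_hasCompactSupport ?_ ?_
    · exact ((continuous_phase_right ε x).comp (by fun_prop)).smul
        (hA.1.continuous.comp (hm.comp (by fun_prop)))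
    · refine HasCompactSupport.intro (hA.2.isCompact.image
        (f := fun r : R3 × R3 × ℝ => r.2.1) (by fun_prop)) fun ξ hξ => ?_
      have h0 : A (midPoint ε x (ξ, y)) = 0 :=
        image_eq_zero_of_notMem_tsupport (f := A) fun h => hξ ⟨_, h, rfl⟩
      rw [h0]
      ext1 v
      rw [smul_apply]
      simp
  have hap : ∫ ξ : R3, phase ε x (ξ, y) • A (midPoint ε x (ξ, y)) v =
      (∫ ξ : R3, phase ε x (ξ, y) • A (midPoint ε x (ξ, y))) v := by
    rw [ContinuousLinearMap.integral_apply hiA]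
    rfl
  rw [hap]
  refine (ContinuousLinearMap.le_opNorm _ _).trans ?_
  gcongr
  have h := hK ((2 : ℝ)⁻¹ • (x + y)) (((2 : ℝ)⁻¹ • (x + y)) 1 / √ε) (ε⁻¹ • (x - y))
  simp only [phase_eq, midPoint]
  exact h

/-- Two-microlocal operators with test symbols are bounded on `L²`, uniformly in `ε`: their kernel
is dominated by the convolution kernel `ε⁻³ (1 + |x - y|/ε)⁻⁴`, of `L¹` norm independent of `ε`. -/
lemma IsTestSymbol.exists_eLpNorm_quant_le {A : R3 × R3 × ℝ → C3 →L[ℂ] C3}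
    (hA : IsTestSymbol A) : ∃ K : ℝ, 0 ≤ K ∧ ∀ ε : ℝ, 0 < ε → ∀ u : 𝓢(R3, C3),
      eLpNorm (quant ε A u) 2 volume ≤ ENNReal.ofReal K * eLpNorm u 2 volume := by
  obtain ⟨K, hK0, hK⟩ := hA.exists_fourier_bound
  have hint : Integrable fun z : R3 => (1 + ‖z‖) ^ (-4 : ℝ) :=
    integrable_one_add_norm (by simp; norm_num)
  have hI0 : 0 ≤ ∫ z : R3, (1 + ‖z‖) ^ (-4 : ℝ) := integral_nonneg fun z => by positivity
  refine ⟨((2 * Real.pi) ^ 3)⁻¹ * K * ∫ z : R3, (1 + ‖z‖) ^ (-4 : ℝ), by positivity,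
    fun ε hε u => ?_⟩
  set k : R3 → ℝ := fun z => ((2 * Real.pi * ε) ^ 3)⁻¹ * (K * (1 + ‖ε⁻¹ • z‖) ^ (-4 : ℝ)) with hk
  have hk0 : ∀ z, 0 ≤ k z := fun z => by positivity
  have hkc : Continuous k := by
    refine continuous_const.mul (continuous_const.mul (Continuous.rpow_const (by fun_prop) ?_))
    exact fun z => Or.inl (by positivity)
  have hpt : ∀ x, ‖quant ε A u x‖ₑ ≤ ∫⁻ y, ENNReal.ofReal (k (x - y)) * ‖u y‖ₑ := by
    intro x
    have hi := integrable_quant hA (continuous_phase_right ε x) ε u.continuous x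
    rw [Measure.volume_eq_prod] at hi
    rw [quant_eq hA ε u.continuous, Measure.volume_eq_prod, integral_prod_symm _ hi,
      ← integral_smul]
    refine (enorm_integral_le_lintegral_enorm _).trans (lintegral_mono fun y => ?_)
    rw [← ofReal_norm, ← ofReal_norm, ← ENNReal.ofReal_mul (hk0 _)]
    refine ENNReal.ofReal_le_ofReal ?_
    rw [norm_smul, Real.norm_of_nonneg (by positivity)]
    have h1 := hA.norm_integral_phase_le hK ε x y (u y)
    calc _ ≤ ((2 * Real.pi * ε) ^ 3)⁻¹ * (K * (1 + ‖ε⁻¹ • (x - y)‖) ^ (-4 : ℝ) * ‖u y‖) := by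
          gcongr
      _ = k (x - y) * ‖u y‖ := by rw [hk]; ring
  refine (eLpNorm_two_le_of_le_convolution (k := fun z => ENNReal.ofReal (k z))
    hkc.measurable.ennreal_ofReal u.continuous hpt).trans_eq ?_
  congr 1
  have hki : Integrable k := by
    refine (Integrable.const_mul ?_ K).const_mul _
    exact hint.comp_smul (inv_ne_zero hε.ne')
  rw [← ofReal_integral_eq_lintegral_ofReal hki (Eventually.of_forall hk0)]
  congr 1
  rw [hk, integral_const_mul, integral_const_mul,
    Measure.integral_comp_inv_smul volume (fun z : R3 => (1 + ‖z‖) ^ (-4 : ℝ)) ε]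
  simp only [finrank_euclideanSpace, Fintype.card_fin, smul_eq_mul]
  rw [abs_of_pos (by positivity)]
  field_simp

/-- Measurability of the functions `quant ε A u`. -/
lemma IsTestSymbol.aestronglyMeasurable_quant {A : R3 × R3 × ℝ → C3 →L[ℂ] C3}
    (hA : IsTestSymbol A) (ε : ℝ) {u : R3 → C3} (hu : Continuous u) :
    AEStronglyMeasurable (quant ε A u) volume := by
  have e : quant ε A u = fun x => (((2 * Real.pi * ε) ^ 3)⁻¹ : ℝ) •
      ∫ q : R3 × R3, phase ε x q • A (midPoint ε x q) (u q.2) := funext (quant_eq hA ε hu)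
  rw [e]
  have hc : Continuous fun r : R3 × R3 × R3 =>
      phase ε r.1 r.2 • A (midPoint ε r.1 r.2) (u r.2.2) :=
    (continuous_phase ε).smul ((hA.1.continuous.comp (continuous_midPoint ε)).clm_apply
      (hu.comp (by fun_prop)))
  exact (hc.stronglyMeasurable.integral_prod_right'.const_smul
    (((2 * Real.pi * ε) ^ 3)⁻¹ : ℝ)).aestronglyMeasurable

/-! ### Microlocal order -/

/-- A family `W ε` of operators on Schwartz functions is of microlocal order `n` when the composite
with every two-microlocal operator with a test symbol is `O(√ε ^ n)` on `L²`, locally uniformly in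
`ε`. -/
def HasMicroOrder (n : ℕ) (W : ℝ → 𝓢(R3, C3) →L[ℂ] 𝓢(R3, C3)) : Prop :=
  ∀ A : R3 × R3 × ℝ → C3 →L[ℂ] C3, IsTestSymbol A → ∀ ε₀ : ℝ, 0 < ε₀ → ∃ K : ℝ, 0 ≤ K ∧
    ∀ ε : ℝ, 0 < ε → ε ≤ ε₀ → ∀ u : 𝓢(R3, C3),
      eLpNorm (quant ε A (W ε u)) 2 volume ≤ ENNReal.ofReal (K * √ε ^ n) * eLpNorm u 2 volume

lemma eLpNorm_add_le_ofReal {f g : R3 → C3} {a b : ℝ} {N : ENNReal} (ha : 0 ≤ a) (hb : 0 ≤ b)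
    (hf : AEStronglyMeasurable f volume) (hg : AEStronglyMeasurable g volume)
    (hfa : eLpNorm f 2 volume ≤ ENNReal.ofReal a * N)
    (hgb : eLpNorm g 2 volume ≤ ENNReal.ofReal b * N) :
    eLpNorm (f + g) 2 volume ≤ ENNReal.ofReal (a + b) * N := by
  rw [ENNReal.ofReal_add ha hb, add_mul]
  exact (eLpNorm_add_le hf hg (by norm_num)).trans (add_le_add hfa hgb)

lemma eLpNorm_smul_le_ofReal {f : R3 → C3} {a : ℝ} {N : ENNReal} (c : ℂ)
    (hfa : eLpNorm f 2 volume ≤ ENNReal.ofReal a * N) :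
    eLpNorm (c • f) 2 volume ≤ ENNReal.ofReal (‖c‖ * a) * N := by
  rw [eLpNorm_const_smul, ENNReal.ofReal_mul (norm_nonneg c), ofReal_norm, mul_assoc]
  gcongr

lemma eLpNorm_le_ofReal_mono {f : R3 → C3} {a b : ℝ} {N : ENNReal} (hab : a ≤ b)
    (hfa : eLpNorm f 2 volume ≤ ENNReal.ofReal a * N) :
    eLpNorm f 2 volume ≤ ENNReal.ofReal b * N :=
  hfa.trans (by gcongr)

namespace HasMicroOrder

variable {n m : ℕ} {W V : ℝ → 𝓢(R3, C3) →L[ℂ] 𝓢(R3, C3)}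

lemma id : HasMicroOrder 0 fun _ => ContinuousLinearMap.id ℂ 𝓢(R3, C3) := by
  intro A hA ε₀ _
  obtain ⟨K, hK0, hK⟩ := hA.exists_eLpNorm_quant_le
  exact ⟨K, hK0, fun ε hε _ u => by simpa using hK ε hε u⟩

lemma mono (hW : HasMicroOrder n W) (hmn : m ≤ n) : HasMicroOrder m W := by
  intro A hA ε₀ hε₀
  obtain ⟨K, hK0, hK⟩ := hW A hA ε₀ hε₀
  refine ⟨K * √ε₀ ^ (n - m), by positivity, fun ε hε hle u => ?_⟩
  refine eLpNorm_le_ofReal_mono ?_ (hK ε hε hle u)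
  have hs : √ε ≤ √ε₀ := Real.sqrt_le_sqrt hle
  calc K * √ε ^ n = K * √ε ^ (n - m) * √ε ^ m := by
        rw [mul_assoc, ← pow_add, Nat.sub_add_cancel hmn]
    _ ≤ _ := by gcongr

lemma congr (hW : HasMicroOrder n W) (h : ∀ ε u, V ε u = W ε u) : HasMicroOrder n V := by
  intro A hA ε₀ hε₀
  simp_rw [h]
  exact hW A hA ε₀ hε₀

lemma add (hW : HasMicroOrder n W) (hV : HasMicroOrder n V) :
    HasMicroOrder n fun ε => W ε + V ε := by
  intro A hA ε₀ hε₀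
  obtain ⟨K, hK0, hK⟩ := hW A hA ε₀ hε₀
  obtain ⟨K', hK0', hK'⟩ := hV A hA ε₀ hε₀
  refine ⟨K + K', by positivity, fun ε hε hle u => ?_⟩
  have e : quant ε A ((W ε + V ε) u) = quant ε A (W ε u) + quant ε A (V ε u) :=
    quant_add hA ε (W ε u).continuous (V ε u).continuous
  rw [e, add_mul]
  exact eLpNorm_add_le_ofReal (by positivity) (by positivity)
    (hA.aestronglyMeasurable_quant ε (W ε u).continuous)
    (hA.aestronglyMeasurable_quant ε (V ε u).continuous) (hK ε hε hle u) (hK' ε hε hle u)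

lemma const_smul (hW : HasMicroOrder n W) (c : ℂ) : HasMicroOrder n fun ε => c • W ε := by
  intro A hA ε₀ hε₀
  obtain ⟨K, hK0, hK⟩ := hW A hA ε₀ hε₀
  refine ⟨‖c‖ * K, by positivity, fun ε hε hle u => ?_⟩
  have e : quant ε A ((c • W ε) u) = c • quant ε A (W ε u) := quant_smul A ε c (W ε u)
  rw [e, mul_assoc]
  exact eLpNorm_smul_le_ofReal c (hK ε hε hle u)

lemma eps_smul (hW : HasMicroOrder n W) : HasMicroOrder (n + 2) fun ε => (ε : ℂ) • W ε := by
  intro A hA ε₀ hε₀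
  obtain ⟨K, hK0, hK⟩ := hW A hA ε₀ hε₀
  refine ⟨K, hK0, fun ε hε hle u => ?_⟩
  have e : quant ε A (((ε : ℂ) • W ε) u) = (ε : ℂ) • quant ε A (W ε u) :=
    quant_smul A ε ε (W ε u)
  rw [e]
  refine eLpNorm_le_ofReal_mono (le_of_eq ?_) (eLpNorm_smul_le_ofReal (ε : ℂ) (hK ε hε hle u))
  rw [Complex.norm_real, Real.norm_of_nonneg hε.le, pow_add, Real.sq_sqrt hε.le]
  ring

lemma comp_right (hW : HasMicroOrder n W) {C : ℝ} (hC : 0 ≤ C)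
    (hV : ∀ ε u, eLpNorm (V ε u) 2 volume ≤ ENNReal.ofReal C * eLpNorm u 2 volume) :
    HasMicroOrder n fun ε => W ε ∘L V ε := by
  intro A hA ε₀ hε₀
  obtain ⟨K, hK0, hK⟩ := hW A hA ε₀ hε₀
  refine ⟨K * C, by positivity, fun ε hε hle u => ?_⟩
  refine (hK ε hε hle (V ε u)).trans ?_
  calc ENNReal.ofReal (K * √ε ^ n) * eLpNorm (V ε u) 2 volume
      ≤ ENNReal.ofReal (K * √ε ^ n) * (ENNReal.ofReal C * eLpNorm u 2 volume) :=
        mul_le_mul_right (hV ε u) _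
    _ = ENNReal.ofReal (K * C * √ε ^ n) * eLpNorm u 2 volume := by
        rw [mul_right_comm, ENNReal.ofReal_mul (by positivity : 0 ≤ K * √ε ^ n), mul_assoc]

/-- A factor `z₁` on the left gains `√ε`. -/
lemma pos_left (hW : HasMicroOrder n W) : HasMicroOrder (n + 1) fun ε => pos 1 ∘L W ε := by
  intro A hA ε₀ hε₀
  have hη : IsTestSymbol fun p : R3 × R3 × ℝ => p.2.2 • A p := hA.smul (by fun_prop)
  have hd := hA.fderiv_apply (0, EuclideanSpace.single 1 1, 0)
  obtain ⟨K, hK0, hK⟩ := hW _ hη ε₀ hε₀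
  obtain ⟨K', hK0', hK'⟩ := hW _ hd ε₀ hε₀
  refine ⟨K + √ε₀ / 2 * K', by positivity, fun ε hε hle u => ?_⟩
  have e := quant_pos hA hε (W ε u)
  rw [sub_eq_add_neg, ← neg_smul] at e
  rw [ContinuousLinearMap.comp_apply, e]
  have hs : √ε ≤ √ε₀ := Real.sqrt_le_sqrt hle
  refine eLpNorm_le_ofReal_mono ?_ (eLpNorm_add_le_ofReal (by positivity) (by positivity)
    ((hη.aestronglyMeasurable_quant ε (W ε u).continuous).const_smul _)
    ((hd.aestronglyMeasurable_quant ε (W ε u).continuous).const_smul _)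
    (eLpNorm_smul_le_ofReal _ (hK ε hε hle u)) (eLpNorm_smul_le_ofReal _ (hK' ε hε hle u)))
  have h1 : ‖((√ε : ℝ) : ℂ)‖ = √ε := by
    rw [Complex.norm_real, Real.norm_of_nonneg (Real.sqrt_nonneg _)]
  have h2 : ‖-(Complex.I * (ε : ℂ) / 2)‖ = √ε * √ε / 2 := by
    rw [Real.mul_self_sqrt hε.le]
    simp [abs_of_pos hε]
  rw [h1, h2]
  calc √ε * (K * √ε ^ n) + √ε * √ε / 2 * (K' * √ε ^ n)
      = (K + √ε / 2 * K') * √ε ^ (n + 1) := by ring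
    _ ≤ _ := by gcongr

/-- Momenta on the left cost nothing: they are bounded on the support of a test symbol. -/
lemma momentum_left (hW : HasMicroOrder n W) (j : Fin 3) :
    HasMicroOrder n fun ε => fmul ε (fun ξ => ((ξ j : ℝ) : ℂ)) ∘L W ε := by
  intro A hA ε₀ hε₀
  have hξ : IsTestSymbol fun p : R3 × R3 × ℝ => p.2.1 j • A p := hA.smul (by fun_prop)
  have hd := hA.fderiv_apply (EuclideanSpace.single j 1, 0, 0)
  have hd' := hA.fderiv_apply (0, 0, 1)
  obtain ⟨K, hK0, hK⟩ := hW _ hξ ε₀ hε₀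
  obtain ⟨K', hK0', hK'⟩ := hW _ hd ε₀ hε₀
  obtain ⟨K'', hK0'', hK''⟩ := hW _ hd' ε₀ hε₀
  refine ⟨K + ε₀ / 2 * K' + √ε₀ / 2 * K'', by positivity, fun ε hε hle u => ?_⟩
  rw [ContinuousLinearMap.comp_apply, quant_momentum hA hε j (W ε u)]
  have hs : √ε ≤ √ε₀ := Real.sqrt_le_sqrt hle
  have m1 := hξ.aestronglyMeasurable_quant ε (W ε u).continuous
  have m2 := (hd.aestronglyMeasurable_quant ε (W ε u).continuous).const_smul (Complex.I * ε / 2)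
  have m3 := (hd'.aestronglyMeasurable_quant ε (W ε u).continuous).const_smul
    (Complex.I * √ε * ((EuclideanSpace.single j (1 : ℝ) : R3) 1 : ℝ) / 2)
  refine eLpNorm_le_ofReal_mono ?_ (eLpNorm_add_le_ofReal (by positivity) (by positivity)
    (m1.add m2) m3 (eLpNorm_add_le_ofReal (by positivity) (by positivity) m1 m2
      (hK ε hε hle u) (eLpNorm_smul_le_ofReal _ (hK' ε hε hle u)))
      (eLpNorm_smul_le_ofReal _ (hK'' ε hε hle u)))
  have h2 : ‖Complex.I * (ε : ℂ) / 2‖ = ε / 2 := by simp [abs_of_pos hε]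
  have h3 : ‖Complex.I * (√ε : ℂ) * ((EuclideanSpace.single j (1 : ℝ) : R3) 1 : ℝ) / 2‖ ≤
      √ε / 2 := by
    have h4 : ‖(((EuclideanSpace.single j (1 : ℝ) : R3) 1 : ℝ) : ℂ)‖ ≤ 1 := by
      rw [Complex.norm_real, PiLp.single_apply]
      split_ifs <;> simp
    rw [norm_div, norm_mul, norm_mul, Complex.norm_I, Complex.norm_real,
      Real.norm_of_nonneg (Real.sqrt_nonneg _), one_mul, Complex.norm_ofNat]
    gcongr
    exact mul_le_of_le_one_right (Real.sqrt_nonneg _) h4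
  rw [h2]
  calc _ ≤ K * √ε ^ n + ε / 2 * (K' * √ε ^ n) + √ε / 2 * (K'' * √ε ^ n) := by gcongr
    _ = (K + ε / 2 * K' + √ε / 2 * K'') * √ε ^ n := by ring
    _ ≤ _ := by gcongr

lemma one_add_norm_sq_mul {G : R3 → ℂ} (hG : G.HasTemperateGrowth)
    (h : HasMicroOrder 0 fun ε => fmul ε G) :
    HasMicroOrder 0 fun ε => fmul ε fun ξ => ((1 + ‖ξ‖ ^ 2 : ℝ) : ℂ) * G ξ := by
  have hj : ∀ j : Fin 3, HasMicroOrder 0 fun ε =>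
      fmul ε (fun ξ => ((ξ j : ℝ) : ℂ)) ∘L (fmul ε (fun ξ => ((ξ j : ℝ) : ℂ)) ∘L fmul ε G) :=
    fun j => (h.momentum_left j).momentum_left j
  have hc := coord_hasTemperateGrowth
  have t : ∀ j : Fin 3, Function.HasTemperateGrowth fun ξ : R3 =>
      ((ξ j : ℝ) : ℂ) * (((ξ j : ℝ) : ℂ) * G ξ) := fun j => (hc j).mul ((hc j).mul hG)
  refine (((h.add (hj 0)).add (hj 1)).add (hj 2)).congr fun ε u => ?_
  simp only [add_apply, ContinuousLinearMap.comp_apply]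
  rw [fmul_fmul ε (hc 0) hG,
    fmul_fmul ε (hc 0) (G := fun ξ => ((ξ 0 : ℝ) : ℂ) * G ξ) ((hc 0).mul hG),
    fmul_fmul ε (hc 1) hG, fmul_fmul ε (hc 1) (G := fun ξ => ((ξ 1 : ℝ) : ℂ) * G ξ) ((hc 1).mul hG),
    fmul_fmul ε (hc 2) hG, fmul_fmul ε (hc 2) (G := fun ξ => ((ξ 2 : ℝ) : ℂ) * G ξ) ((hc 2).mul hG),
    ← fmul_add ε hG (t 0), ← fmul_add ε (F := fun ξ => _ + _) (hG.add (t 0)) (t 1),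
    ← fmul_add ε (F := fun ξ => _ + _ + _) ((hG.add (t 0)).add (t 1)) (t 2)]
  congr 2
  ext1 ξ
  rw [EuclideanSpace.real_norm_sq_eq, Fin.sum_univ_three]
  push_cast
  ring

/-- Multipliers of temperate growth are of microlocal order zero, although they are unbounded on
`L²`: such a multiplier is a power of `1 + |εD|²` times a bounded one, and momenta can be absorbed
in the test symbol. -/
lemma fmul {F : R3 → ℂ} (hF : F.HasTemperateGrowth) : HasMicroOrder 0 fun ε => fmul ε F := by
  obtain ⟨k, C, hC⟩ := hF.2 0
  simp only [norm_iteratedFDeriv_zero] at hC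
  have hJ : ∀ m : ℤ, Function.HasTemperateGrowth fun ξ : R3 => (((1 + ‖ξ‖ ^ 2) ^ m : ℝ) : ℂ) := by
    intro m
    have := Function.hasTemperateGrowth_one_add_norm_sq_rpow R3 (m : ℝ)
    simp only [Real.rpow_intCast] at this
    exact (Complex.ofRealCLM.hasTemperateGrowth).comp this
  -- `G` is bounded, since `F` grows at most like `(1 + ‖ξ‖) ^ k`
  set G : R3 → ℂ := fun ξ => (((1 + ‖ξ‖ ^ 2) ^ (-k : ℤ) : ℝ) : ℂ) * F ξ with hG
  have hGt : G.HasTemperateGrowth := (hJ _).mul hF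
  have hC0 : 0 ≤ C := by
    have := (norm_nonneg _).trans (hC 0)
    simpa using this
  have hGb : ∀ ξ, ‖G ξ‖ ≤ 2 ^ k * C := by
    intro ξ
    have hpos : 0 < 1 + ‖ξ‖ ^ 2 := by positivity
    rw [hG, norm_mul, Complex.norm_real, Real.norm_of_nonneg (by positivity), zpow_neg,
      zpow_natCast, inv_mul_le_iff₀ (by positivity)]
    refine (hC ξ).trans ?_
    have h1 : 1 + ‖ξ‖ ≤ 2 * (1 + ‖ξ‖ ^ 2) := by nlinarith [sq_nonneg (‖ξ‖ - 1), norm_nonneg ξ]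
    calc C * (1 + ‖ξ‖) ^ k ≤ C * (2 * (1 + ‖ξ‖ ^ 2)) ^ k := by gcongr
      _ = _ := by rw [mul_pow]; ring
  have hind : ∀ m : ℕ, HasMicroOrder 0 fun ε =>
      _root_.fmul ε fun ξ => (((1 + ‖ξ‖ ^ 2) ^ m : ℝ) : ℂ) * G ξ := by
    intro m
    induction m with
    | zero =>
      simp only [pow_zero, Complex.ofReal_one, one_mul]
      exact id.comp_right (V := fun ε => _root_.fmul ε G) (by positivity)
        fun ε u => eLpNorm_fmul_le ε hGt hGb u
    | succ m ih =>
      have ht : Function.HasTemperateGrowth fun ξ : R3 => (((1 + ‖ξ‖ ^ 2) ^ m : ℝ) : ℂ) * G ξ := by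
        have := hJ m
        simp only [zpow_natCast] at this
        exact this.mul hGt
      refine (ih.one_add_norm_sq_mul ht).congr fun ε u => ?_
      congr 2
      ext1 ξ
      rw [pow_succ']
      push_cast
      ring
  refine (hind k).congr fun ε u => ?_
  congr 2
  ext1 ξ
  have hpos : (1 + ‖ξ‖ ^ 2 : ℝ) ≠ 0 := by positivity
  rw [hG, ← mul_assoc, ← Complex.ofReal_mul, zpow_neg, zpow_natCast,
    mul_inv_cancel₀ (by positivity)]
  simp

end HasMicroOrder

/-! ### Weyl quantization of symbols affine in the position -/

/-- The Weyl quantization of `a` maps every Schwartz function `u` to the Schwartz function `T u`,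
through absolutely convergent iterated integrals. -/
def IsWeylQuantization (ε : ℝ) (a : R3 × R3 → Mat3) (T : 𝓢(R3, C3) →L[ℂ] 𝓢(R3, C3)) : Prop :=
  ∀ (u : 𝓢(R3, C3)) (x : R3),
    (∀ ξ : R3, Integrable fun y : R3 => phase ε x (ξ, y) •
      WithLp.toLp 2 (a ((2 : ℝ)⁻¹ • (x + y), ξ) *ᵥ (u y).ofLp)) ∧
    (Integrable fun ξ : R3 => ∫ y : R3, phase ε x (ξ, y) •
      WithLp.toLp 2 (a ((2 : ℝ)⁻¹ • (x + y), ξ) *ᵥ (u y).ofLp)) ∧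
    weylOp ε a u x = T u x

/-- The Weyl quantization of `x_i F(ξ)`, which is half the anticommutator of `x_i` and `F(εD)`,
written with the coordinate on the left. -/
def weylPos (ε : ℝ) (i : Fin 3) (F : R3 → ℂ) : 𝓢(R3, C3) →L[ℂ] 𝓢(R3, C3) :=
  pos i ∘L fmul ε F -
    (Complex.I * ε / 2) • fmul ε fun ξ => fderiv ℝ F ξ (EuclideanSpace.single i (1 : ℝ))

lemma weylOp_apply (ε : ℝ) (a : R3 × R3 → Mat3) (u : R3 → C3) (x : R3) :
    weylOp ε a u x = (((2 * Real.pi * ε) ^ 3)⁻¹ : ℝ) • ∫ ξ : R3, ∫ y : R3, phase ε x (ξ, y) •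
      WithLp.toLp 2 (a ((2 : ℝ)⁻¹ • (x + y), ξ) *ᵥ (u y).ofLp) := rfl

lemma integrable_phase_smul (ε : ℝ) (x ξ : R3) (v : 𝓢(R3, C3)) :
    Integrable fun y : R3 => phase ε x (ξ, y) • v y := by
  refine v.integrable.norm.mono' ?_ (Eventually.of_forall fun y => ?_)
  · exact (((continuous_phase_right ε x).comp (by fun_prop)).smul
      v.continuous).aestronglyMeasurable
  · rw [norm_smul, norm_phase, one_mul]

lemma integral_phase_smul (ε : ℝ) (x ξ : R3) (v : 𝓢(R3, C3)) :
    ∫ y : R3, phase ε x (ξ, y) • v y =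
      Complex.exp ((ε⁻¹ * inner ℝ ξ x : ℝ) * Complex.I) •
        (𝓕 v : 𝓢(R3, C3)) ((2 * Real.pi * ε)⁻¹ • ξ) := by
  rw [SchwartzMap.fourier_coe, Real.fourier_eq', ← integral_smul]
  congr 1; ext1 y
  rw [smul_smul, ← Complex.exp_add, phase_eq]
  congr 2
  rw [← add_mul, ← Complex.ofReal_add]
  congr 2
  rw [real_inner_smul_right, inner_sub_right, real_inner_smul_right, real_inner_comm y ξ]
  have := Real.pi_ne_zero
  rw [mul_inv]
  field_simp
  ring

/-- Fourier inversion in semiclassical scaling. -/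
lemma integral_multiplier_phase {ε : ℝ} (hε : 0 < ε) {F : R3 → ℂ} (hF : F.HasTemperateGrowth)
    (v : 𝓢(R3, C3)) (x : R3) :
    (Integrable fun ξ : R3 => F ξ • ∫ y : R3, phase ε x (ξ, y) • v y) ∧
    (((2 * Real.pi * ε) ^ 3)⁻¹ : ℝ) • ∫ ξ : R3, F ξ • ∫ y : R3, phase ε x (ξ, y) • v y =
      fmul ε F v x := by
  have hc : 0 < 2 * Real.pi * ε := by positivity
  set g : R3 → C3 := fun k => Complex.exp ((2 * Real.pi * inner ℝ k x : ℝ) * Complex.I) •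
    (𝓕 (fmul ε F v) : 𝓢(R3, C3)) k with hg
  have e : (fun ξ : R3 => F ξ • ∫ y : R3, phase ε x (ξ, y) • v y) =
      fun ξ => g ((2 * Real.pi * ε)⁻¹ • ξ) := by
    ext1 ξ
    simp only [hg]
    rw [integral_phase_smul, fourier_fmul ε hF, smul_smul, smul_smul, smul_smul,
      mul_inv_cancel₀ hc.ne', one_smul, mul_comm]
    congr 4
    rw [real_inner_smul_left]
    have := Real.pi_ne_zero
    field_simp
  have hgi : Integrable g := by
    refine (𝓕 (fmul ε F v) : 𝓢(R3, C3)).integrable.norm.mono' ?_ (Eventually.of_forall fun k => ?_)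
    · refine Continuous.aestronglyMeasurable ?_
      exact Continuous.smul (f := fun k : R3 => Complex.exp ((2 * Real.pi * inner ℝ k x : ℝ) *
        Complex.I)) (by fun_prop) (SchwartzMap.continuous _)
    · rw [hg, norm_smul, Complex.norm_exp_ofReal_mul_I, one_mul]
  have hinv : fmul ε F v x = ∫ k, g k := by
    conv_lhs => rw [← FourierTransform.fourierInv_fourier_eq (F := 𝓢(R3, C3)) (fmul ε F v)]
    rw [SchwartzMap.fourierInv_coe, Real.fourierInv_eq']
  rw [e]
  refine ⟨hgi.comp_smul (inv_ne_zero hc.ne'), ?_⟩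
  rw [Measure.integral_comp_inv_smul, hinv, smul_smul]
  simp only [finrank_euclideanSpace, Fintype.card_fin]
  rw [abs_of_pos (by positivity), inv_mul_cancel₀ (by positivity), one_smul]

namespace IsWeylQuantization

variable {ε : ℝ}

lemma weylOp_eq {a : R3 × R3 → Mat3} {T : 𝓢(R3, C3) →L[ℂ] 𝓢(R3, C3)}
    (h : IsWeylQuantization ε a T) (u : 𝓢(R3, C3)) : weylOp ε a u = T u :=
  funext fun x => (h u x).2.2

lemma add {a b : R3 × R3 → Mat3} {S T : 𝓢(R3, C3) →L[ℂ] 𝓢(R3, C3)}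
    (ha : IsWeylQuantization ε a S) (hb : IsWeylQuantization ε b T) :
    IsWeylQuantization ε (fun p => a p + b p) (S + T) := by
  intro u x
  obtain ⟨a1, a2, a3⟩ := ha u x
  obtain ⟨b1, b2, b3⟩ := hb u x
  have e0 : ∀ ξ y : R3, phase ε x (ξ, y) • WithLp.toLp 2
      ((a ((2 : ℝ)⁻¹ • (x + y), ξ) + b ((2 : ℝ)⁻¹ • (x + y), ξ)) *ᵥ (u y).ofLp) =
      phase ε x (ξ, y) • WithLp.toLp 2 (a ((2 : ℝ)⁻¹ • (x + y), ξ) *ᵥ (u y).ofLp) +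
      phase ε x (ξ, y) • WithLp.toLp 2 (b ((2 : ℝ)⁻¹ • (x + y), ξ) *ᵥ (u y).ofLp) := fun ξ y => by
    rw [Matrix.add_mulVec, WithLp.toLp_add, smul_add]
  simp only [e0]
  refine ⟨fun ξ => (a1 ξ).add (b1 ξ), ?_, ?_⟩
  · exact (a2.add b2).congr (Eventually.of_forall fun ξ => (integral_add (a1 ξ) (b1 ξ)).symm)
  · rw [add_apply, add_apply, ← a3, ← b3, weylOp_apply, weylOp_apply, weylOp_apply]
    simp only [e0]
    rw [integral_congr_ae (Eventually.of_forall fun ξ => integral_add (a1 ξ) (b1 ξ)),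
      integral_add a2 b2, smul_add]

/-- The quantization of a function of `ξ` alone is a Fourier multiplier. -/
lemma multiplier (hε : 0 < ε) {F : R3 → ℂ} (hF : F.HasTemperateGrowth) (M : Mat3) :
    IsWeylQuantization ε (fun p => F p.2 • M) (fmul ε F ∘L matAct M) := by
  intro u x
  have e : ∀ ξ y : R3, phase ε x (ξ, y) • WithLp.toLp 2 ((F ξ • M) *ᵥ (u y).ofLp) =
      F ξ • (phase ε x (ξ, y) • matAct M u y) := fun ξ y => by
    rw [Matrix.smul_mulVec, WithLp.toLp_smul, smul_comm]
    rfl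
  obtain ⟨h1, h2⟩ := integral_multiplier_phase hε hF (matAct M u) x
  refine ⟨fun ξ => ?_, ?_, ?_⟩
  · simp only [e]
    exact (integrable_phase_smul ε x ξ _).smul (F ξ)
  · simp only [e, integral_smul]
    exact h1
  · rw [ContinuousLinearMap.comp_apply, ← h2]
    rw [weylOp_apply]
    simp only [e, integral_smul]

/-- The quantization of `x_i F(ξ)`: the factor `(x_i + y_i)/2` splits the integral into the two
orders of composition of `x_i` and `F(εD)`. -/
lemma coord_mul (hε : 0 < ε) (i : Fin 3) {F : R3 → ℂ} (hF : F.HasTemperateGrowth) (M : Mat3) :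
    IsWeylQuantization ε (fun p => (((p.1 i : ℝ) : ℂ) * F p.2) • M)
      (weylPos ε i F ∘L matAct M) := by
  intro u x
  set v := matAct M u with hv
  have e : ∀ ξ y : R3, phase ε x (ξ, y) • WithLp.toLp 2
      ((((((2 : ℝ)⁻¹ • (x + y)) i : ℝ) : ℂ) * F ξ) • M *ᵥ (u y).ofLp) =
      ((x i : ℂ) / 2) • F ξ • (phase ε x (ξ, y) • v y) +
        (2⁻¹ : ℂ) • F ξ • (phase ε x (ξ, y) • pos i v y) := fun ξ y => by
    rw [WithLp.toLp_smul, show WithLp.toLp 2 (M *ᵥ (u y).ofLp) = v y from rfl, pos_apply]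
    simp only [smul_smul, ← add_smul]
    congr 1
    simp
    ring
  have e' : ∀ ξ y : R3, phase ε x (ξ, y) • WithLp.toLp 2
      (((((((2 : ℝ)⁻¹ • (x + y)) i : ℝ) : ℂ) * F ξ) • M) *ᵥ (u y).ofLp) =
      ((x i : ℂ) / 2) • F ξ • (phase ε x (ξ, y) • v y) +
        (2⁻¹ : ℂ) • F ξ • (phase ε x (ξ, y) • pos i v y) := fun ξ y => by
    rw [Matrix.smul_mulVec, e]
  have i1 : ∀ ξ, Integrable fun y => ((x i : ℂ) / 2) • F ξ • (phase ε x (ξ, y) • v y) := fun ξ =>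
    ((integrable_phase_smul ε x ξ v).smul (F ξ)).smul ((x i : ℂ) / 2)
  have i2 : ∀ ξ, Integrable fun y => (2⁻¹ : ℂ) • F ξ • (phase ε x (ξ, y) • pos i v y) := fun ξ =>
    ((integrable_phase_smul ε x ξ (pos i v)).smul (F ξ)).smul (2⁻¹ : ℂ)
  obtain ⟨h1, h2⟩ := integral_multiplier_phase hε hF v x
  obtain ⟨k1, k2⟩ := integral_multiplier_phase hε hF (pos i v) x
  have e2 : ∀ ξ : R3, ∫ y : R3, phase ε x (ξ, y) • WithLp.toLp 2
      (((((((2 : ℝ)⁻¹ • (x + y)) i : ℝ) : ℂ) * F ξ) • M) *ᵥ (u y).ofLp) =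
      ((x i : ℂ) / 2) • (F ξ • ∫ y : R3, phase ε x (ξ, y) • v y) +
        (2⁻¹ : ℂ) • (F ξ • ∫ y : R3, phase ε x (ξ, y) • pos i v y) := fun ξ => by
    simp only [e']
    rw [integral_add (i1 ξ) (i2 ξ), integral_smul, integral_smul, integral_smul, integral_smul]
  have j1 : Integrable fun ξ => ((x i : ℂ) / 2) • (F ξ • ∫ y : R3, phase ε x (ξ, y) • v y) :=
    h1.smul ((x i : ℂ) / 2)
  have j2 : Integrable fun ξ => (2⁻¹ : ℂ) • (F ξ • ∫ y : R3, phase ε x (ξ, y) • pos i v y) :=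
    k1.smul (2⁻¹ : ℂ)
  refine ⟨fun ξ => ?_, ?_, ?_⟩
  · simp only [e']
    exact (i1 ξ).add (i2 ξ)
  · simp only [e2]
    exact j1.add j2
  · rw [weylOp_apply]
    simp only [e2]
    rw [integral_add j1 j2, integral_smul, integral_smul,
      smul_add, smul_comm _ ((x i : ℂ) / 2), smul_comm _ (2⁻¹ : ℂ), h2, k2, fmul_pos ε hF]
    rw [ContinuousLinearMap.comp_apply, ← hv, weylPos, sub_apply, sub_apply, sub_apply,
      ContinuousLinearMap.comp_apply, smul_apply, smul_apply, smul_apply, pos_apply,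
      smul_sub, smul_smul, smul_smul, ← add_sub_assoc, ← add_smul]
    congr 2 <;> ring

end IsWeylQuantization

/-! ### Symbols and the Hadamard quotient -/

namespace IsSymbol

variable {E F G : Type*} [NormedAddCommGroup E] [NormedSpace ℝ E] [NormedAddCommGroup F]
  [NormedSpace ℝ F] [NormedAddCommGroup G] [NormedSpace ℝ G]

lemma hasTemperateGrowth {f : E → F} (hf : IsSymbol f) : f.HasTemperateGrowth := by
  obtain ⟨h, m, hm⟩ := hf
  exact ⟨h, fun k => ⟨m, hm k⟩⟩

lemma clm (L : E →L[ℝ] F) : IsSymbol L := by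
  refine ⟨L.contDiff, 1, fun k => ⟨‖L‖, fun x => ?_⟩⟩
  have h1 : ‖L‖ ≤ ‖L‖ * (1 + ‖x‖) ^ 1 := by
    rw [pow_one]
    exact le_mul_of_one_le_right (norm_nonneg _) (by simp)
  match k with
  | 0 =>
    rw [norm_iteratedFDeriv_zero, pow_one]
    exact (L.le_opNorm x).trans (by gcongr; simp)
  | k + 1 =>
    have hd : fderiv ℝ L = fun _ => L := by ext1 v; exact L.fderiv
    rw [← norm_iteratedFDeriv_fderiv, hd]
    match k with
    | 0 => rwa [norm_iteratedFDeriv_zero]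
    | k + 1 =>
      rw [iteratedFDeriv_const_of_ne (by simp)]
      simpa using (norm_nonneg L).trans h1

lemma clm_comp {f : E → F} (hf : IsSymbol f) (L : F →L[ℝ] G) : IsSymbol fun x => L (f x) := by
  obtain ⟨h, m, hm⟩ := hf
  refine ⟨L.contDiff.comp h, m, fun k => ?_⟩
  obtain ⟨K, hK⟩ := hm k
  refine ⟨‖L‖ * K, fun x => ?_⟩
  rw [mul_assoc]
  exact (L.norm_iteratedFDeriv_comp_left h.contDiffAt (mod_cast le_top)).trans
    (by gcongr; exact hK x)

lemma const_nonneg {f : E → F} {m k : ℕ} {K : ℝ}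
    (h : ∀ x, ‖iteratedFDeriv ℝ k f x‖ ≤ K * (1 + ‖x‖) ^ m) : 0 ≤ K := by
  simpa using (norm_nonneg _).trans (h 0)

lemma comp_clm {f : F → G} (hf : IsSymbol f) (L : E →L[ℝ] F) : IsSymbol fun x => f (L x) := by
  obtain ⟨h, m, hm⟩ := hf
  refine ⟨h.comp L.contDiff, m, fun k => ?_⟩
  obtain ⟨K, hK⟩ := hm k
  have hK0 := const_nonneg hK
  refine ⟨K * (1 + ‖L‖) ^ m * ‖L‖ ^ k, fun x => ?_⟩
  have e : iteratedFDeriv ℝ k (fun x => f (L x)) x = _ :=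
    L.iteratedFDeriv_comp_right h x (i := k) (mod_cast le_top)
  rw [e]
  refine (ContinuousMultilinearMap.norm_compContinuousLinearMap_le _ _).trans ?_
  rw [Finset.prod_const, Finset.card_univ, Fintype.card_fin]
  have h1 : 1 + ‖L x‖ ≤ (1 + ‖L‖) * (1 + ‖x‖) := by
    nlinarith [L.le_opNorm x, norm_nonneg L, norm_nonneg x]
  calc _ ≤ K * (1 + ‖L x‖) ^ m * ‖L‖ ^ k := by gcongr; exact hK _
    _ ≤ K * ((1 + ‖L‖) * (1 + ‖x‖)) ^ m * ‖L‖ ^ k := by gcongr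
    _ = _ := by rw [mul_pow]; ring

lemma mul {f g : E → ℝ} (hf : IsSymbol f) (hg : IsSymbol g) : IsSymbol fun x => f x * g x := by
  obtain ⟨h, m, hm⟩ := hf
  obtain ⟨h', m', hm'⟩ := hg
  refine ⟨h.mul h', m + m', fun k => ?_⟩
  choose K hK using hm
  choose K' hK' using hm'
  refine ⟨∑ i ∈ Finset.range (k + 1), (k.choose i : ℝ) * K i * K' (k - i), fun x => ?_⟩
  refine (norm_iteratedFDeriv_mul_le h h' x (mod_cast le_top)).trans ?_
  rw [Finset.sum_mul]
  refine Finset.sum_le_sum fun i _ => ?_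
  have := const_nonneg (hK i)
  calc _ ≤ (k.choose i : ℝ) * (K i * (1 + ‖x‖) ^ m) * (K' (k - i) * (1 + ‖x‖) ^ m') := by
        gcongr
        · exact hK i x
        · exact hK' _ x
    _ = _ := by rw [pow_add]; ring

end IsSymbol

/-- Differentiation under the integral sign for a smooth integrand. -/
lemma hasFDerivAt_intervalIntegral {E : Type} [NormedAddCommGroup E] [NormedSpace ℝ E]
    {g : ℝ × R3 → E} (hg : ContDiff ℝ ∞ g) (ξ : R3) :
    HasFDerivAt (fun ξ => ∫ t in (0 : ℝ)..1, g (t, ξ))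
      (∫ t in (0 : ℝ)..1, (fderiv ℝ g (t, ξ)) ∘L ContinuousLinearMap.inr ℝ ℝ R3) ξ := by
  have hc : Continuous fun r : ℝ × R3 => (fderiv ℝ g r) ∘L ContinuousLinearMap.inr ℝ ℝ R3 :=
    (hg.continuous_fderiv (by simp)).clm_comp continuous_const
  obtain ⟨M, hM⟩ := (isCompact_Icc (a := (0 : ℝ)) (b := 1)).prod
    (isCompact_closedBall ξ 1) |>.exists_bound_of_continuousOn hc.continuousOn
  refine intervalIntegral.hasFDerivAt_integral_of_dominated_of_fderiv_le (bound := fun _ => M)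
    (F' := fun ξ t => (fderiv ℝ g (t, ξ)) ∘L ContinuousLinearMap.inr ℝ ℝ R3)
    (Metric.ball_mem_nhds ξ one_pos) ?_ ?_ ?_ ?_ ?_ ?_
  · exact Eventually.of_forall fun ζ =>
      (hg.continuous.comp (by fun_prop : Continuous fun t : ℝ => (t, ζ))).aestronglyMeasurable
  · exact (hg.continuous.comp (by fun_prop : Continuous fun t : ℝ => (t, ξ))).intervalIntegrable _ _
  · exact (hc.comp (by fun_prop : Continuous fun t : ℝ => (t, ξ))).aestronglyMeasurable
  · refine Eventually.of_forall fun t ht ζ hζ => hM (t, ζ) ⟨?_, Metric.ball_subset_closedBall hζ⟩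
    rw [Set.uIoc_of_le zero_le_one] at ht
    exact Set.Ioc_subset_Icc_self ht
  · exact intervalIntegrable_const
  · refine Eventually.of_forall fun t _ ζ _ => ?_
    exact ((hg.differentiable (by simp) (t, ζ)).hasFDerivAt).comp ζ (hasFDerivAt_prodMk_right t ζ)

/-- The target `E` is quantified in the statement because the induction replaces it by the space of
linear maps `R3 →L[ℝ] E`. -/
lemma contDiff_intervalIntegral (n : ℕ) : ∀ {E : Type} [NormedAddCommGroup E] [NormedSpace ℝ E]
    {g : ℝ × R3 → E}, ContDiff ℝ ∞ g → ContDiff ℝ n fun ξ => ∫ t in (0 : ℝ)..1, g (t, ξ) := by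
  induction n with
  | zero =>
    intro E _ _ g hg
    exact contDiff_zero.2 (continuous_iff_continuousAt.2
      fun ξ => (hasFDerivAt_intervalIntegral hg ξ).continuousAt)
  | succ n ih =>
    intro E _ _ g hg
    push_cast
    refine contDiff_succ_iff_hasFDerivAt.2 ⟨_, ?_, hasFDerivAt_intervalIntegral hg⟩
    exact ih ((hg.fderiv_right (by simp)).clm_comp contDiff_const)

lemma norm_iteratedFDeriv_intervalIntegral_le (k : ℕ) :
    ∀ {E : Type} [NormedAddCommGroup E] [NormedSpace ℝ E] {g : ℝ × R3 → E}, ContDiff ℝ ∞ g →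
      ∀ (ξ : R3) (B : ℝ),
      (∀ t ∈ Set.Icc (0 : ℝ) 1, ‖iteratedFDeriv ℝ k (fun ζ => g (t, ζ)) ξ‖ ≤ B) →
      ‖iteratedFDeriv ℝ k (fun ξ => ∫ t in (0 : ℝ)..1, g (t, ξ)) ξ‖ ≤ B := by
  induction k with
  | zero =>
    intro E _ _ g hg ξ B hB
    simp only [norm_iteratedFDeriv_zero] at hB ⊢
    refine (intervalIntegral.norm_integral_le_of_norm_le_const (C := B) fun t ht => hB t ?_).trans
      (by simp)
    rw [Set.uIoc_of_le zero_le_one] at ht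
    exact Set.Ioc_subset_Icc_self ht
  | succ k ih =>
    intro E _ _ g hg ξ B hB
    have hd : fderiv ℝ (fun ξ => ∫ t in (0 : ℝ)..1, g (t, ξ)) = _ :=
      funext fun ξ => (hasFDerivAt_intervalIntegral hg ξ).fderiv
    rw [← norm_iteratedFDeriv_fderiv, hd]
    refine ih (g := fun r => (fderiv ℝ g r) ∘L ContinuousLinearMap.inr ℝ ℝ R3)
      ((hg.fderiv_right (by simp)).clm_comp contDiff_const) ξ B fun t ht => ?_
    have hd' : (fun ζ => (fderiv ℝ g (t, ζ)) ∘L ContinuousLinearMap.inr ℝ ℝ R3) =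
        fderiv ℝ fun ζ => g (t, ζ) := funext fun ζ =>
      (((hg.differentiable (by simp) (t, ζ)).hasFDerivAt).comp ζ
        (hasFDerivAt_prodMk_right t ζ)).fderiv.symm
    rw [hd', norm_iteratedFDeriv_fderiv]
    exact hB t ht

/-- The linear map `(σ, ζ) ↦ (tσ, ζ)`. -/
def shrink (t : ℝ) : R3 →L[ℝ] R3 :=
  ContinuousLinearMap.id ℝ R3 -
    (1 - t) • (EuclideanSpace.proj 0 : R3 →L[ℝ] ℝ).smulRight (EuclideanSpace.single 0 (1 : ℝ))

lemma shrink_apply (t : ℝ) (ξ : R3) :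
    shrink t ξ = ξ - ((1 - t) * ξ 0) • EuclideanSpace.single 0 (1 : ℝ) := by
  simp [shrink, smul_smul]

lemma norm_shrink_le {t : ℝ} (ht : t ∈ Set.Icc (0 : ℝ) 1) : ‖shrink t‖ ≤ 1 := by
  refine ContinuousLinearMap.opNorm_le_bound _ zero_le_one fun ξ => ?_
  rw [one_mul, EuclideanSpace.norm_eq, EuclideanSpace.norm_eq]
  refine Real.sqrt_le_sqrt (Finset.sum_le_sum fun i _ => ?_)
  refine pow_le_pow_left₀ (norm_nonneg _) ?_ 2
  rw [shrink_apply]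
  fin_cases i
  · have : (ξ - ((1 - t) * ξ 0) • (EuclideanSpace.single 0 (1 : ℝ) : R3)) 0 = t * ξ 0 := by
      simp; ring
    change ‖(ξ - ((1 - t) * ξ 0) • (EuclideanSpace.single 0 (1 : ℝ) : R3)) 0‖ ≤ ‖ξ 0‖
    rw [this, norm_mul, Real.norm_of_nonneg ht.1]
    exact mul_le_of_le_one_left (norm_nonneg _) ht.2
  · simp
  · simp

/-- The quotient `(α(σ, ζ) - α(0, ζ)) / σ`, extended smoothly to `σ = 0`, in Hadamard's integral
form. -/
def hadamardQuotient (α : R3 → ℝ) (ξ : R3) : ℝ :=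
  ∫ t in (0 : ℝ)..1, fderiv ℝ α (shrink t ξ) (EuclideanSpace.single 0 1)

lemma coord_mul_hadamardQuotient {α : R3 → ℝ} (hα : ContDiff ℝ ∞ α) (ξ : R3) :
    ξ 0 * hadamardQuotient α ξ = α ξ - α !₂[0, ξ 1, ξ 2] := by
  have h1 : shrink 1 ξ = ξ := by rw [shrink_apply]; simp
  have h0 : shrink 0 ξ = !₂[0, ξ 1, ξ 2] := by
    rw [shrink_apply]; ext i; fin_cases i <;> simp
  have hs : ∀ t : ℝ, HasDerivAt (fun t => shrink t ξ)
      (ξ 0 • (EuclideanSpace.single 0 (1 : ℝ) : R3)) t := by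
    intro t
    simp_rw [shrink_apply]
    have := (((hasDerivAt_id t).const_sub 1).mul_const (ξ 0)).smul_const
      (EuclideanSpace.single 0 (1 : ℝ) : R3) |>.const_sub ξ
    simpa using this
  have hd : ∀ t ∈ Set.uIcc (0 : ℝ) 1, HasDerivAt (fun t => α (shrink t ξ))
      (ξ 0 * fderiv ℝ α (shrink t ξ) (EuclideanSpace.single 0 1)) t := by
    intro t _
    have := ((hα.differentiable (by simp) (shrink t ξ)).hasFDerivAt).comp_hasDerivAt t (hs t)
    rwa [map_smul, smul_eq_mul] at this
  have hsc : Continuous fun t => shrink t ξ :=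
    continuous_iff_continuousAt.2 fun t => (hs t).continuousAt
  have hc : Continuous fun t : ℝ => ξ 0 * fderiv ℝ α (shrink t ξ) (EuclideanSpace.single 0 1) :=
    continuous_const.mul (((hα.continuous_fderiv (by simp)).comp hsc).clm_apply continuous_const)
  have := intervalIntegral.integral_eq_sub_of_hasDerivAt hd (hc.intervalIntegrable _ _)
  rw [h1, h0, intervalIntegral.integral_const_mul] at this
  exact this

lemma isSymbol_hadamardQuotient {α : R3 → ℝ} (hα : IsSymbol α) :
    IsSymbol (hadamardQuotient α) := by
  obtain ⟨h, m, hm⟩ := hα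
  set e0 : R3 := EuclideanSpace.single 0 (1 : ℝ) with he0
  have hsh : ContDiff ℝ ∞ fun r : ℝ × R3 => shrink r.1 r.2 := by
    simp_rw [shrink_apply]
    have hc : ContDiff ℝ ∞ fun r : ℝ × R3 => (1 - r.1) * r.2 0 :=
      (contDiff_const.sub contDiff_fst).mul
        ((EuclideanSpace.proj 0 : R3 →L[ℝ] ℝ).contDiff.comp contDiff_snd)
    exact contDiff_snd.sub (hc.smul contDiff_const)
  have hg : ContDiff ℝ ∞ fun r : ℝ × R3 => fderiv ℝ α (shrink r.1 r.2) e0 :=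
    ((h.fderiv_right (by simp)).comp hsh).clm_apply contDiff_const
  refine ⟨contDiff_infty.2 fun n => contDiff_intervalIntegral n hg, m, fun k => ?_⟩
  obtain ⟨K, hK⟩ := hm (k + 1)
  have hK0 := IsSymbol.const_nonneg hK
  refine ⟨K, fun ξ => norm_iteratedFDeriv_intervalIntegral_le k hg ξ _ fun t ht => ?_⟩
  have hd : ContDiff ℝ ∞ (fderiv ℝ α) := h.fderiv_right (by simp)
  set L : (R3 →L[ℝ] ℝ) →L[ℝ] ℝ := ContinuousLinearMap.apply ℝ ℝ e0 with hL
  have hL1 : ‖L‖ ≤ 1 := by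
    refine ContinuousLinearMap.opNorm_le_bound _ zero_le_one fun A => ?_
    rw [one_mul]
    simpa [hL, he0] using A.le_opNorm e0
  have hx : ‖shrink t ξ‖ ≤ ‖ξ‖ := by
    simpa using (shrink t).le_of_opNorm_le (norm_shrink_le ht) ξ
  have e : (fun ζ => fderiv ℝ α (shrink t ζ) e0) = ⇑L ∘ (fderiv ℝ α ∘ shrink t) := rfl
  rw [e]
  calc _ ≤ ‖L‖ * ‖iteratedFDeriv ℝ k (fderiv ℝ α ∘ shrink t) ξ‖ :=
        L.norm_iteratedFDeriv_comp_left (hd.comp (shrink t).contDiff).contDiffAt (mod_cast le_top)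
    _ ≤ 1 * ‖iteratedFDeriv ℝ k (fderiv ℝ α ∘ shrink t) ξ‖ := by gcongr
    _ ≤ 1 * ‖iteratedFDeriv ℝ k (fderiv ℝ α) (shrink t ξ)‖ := by
        gcongr
        rw [(shrink t).iteratedFDeriv_comp_right hd ξ (mod_cast le_top)]
        refine (ContinuousMultilinearMap.norm_compContinuousLinearMap_le _ _).trans ?_
        refine mul_le_of_le_one_right (norm_nonneg _) ?_
        exact Finset.prod_le_one (fun _ _ => norm_nonneg _) fun _ _ => norm_shrink_le ht
    _ = ‖iteratedFDeriv ℝ (k + 1) α (shrink t ξ)‖ := by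
        rw [one_mul, norm_iteratedFDeriv_fderiv]
    _ ≤ K * (1 + ‖shrink t ξ‖) ^ m := hK _
    _ ≤ K * (1 + ‖ξ‖) ^ m := by gcongr

/-! ### The operators with symbols `x_i F(ξ)` -/

lemma weylPos_apply (ε : ℝ) (i : Fin 3) (F : R3 → ℂ) (u : 𝓢(R3, C3)) :
    weylPos ε i F u = pos i (fmul ε F u) - (Complex.I * ε / 2) •
      fmul ε (fun ξ => fderiv ℝ F ξ (EuclideanSpace.single i (1 : ℝ))) u := rfl

lemma weylPos_matAct (ε : ℝ) (i : Fin 3) {F : R3 → ℂ} (hF : F.HasTemperateGrowth) (M : Mat3)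
    (u : 𝓢(R3, C3)) : weylPos ε i F (matAct M u) = matAct M (weylPos ε i F u) := by
  simp only [weylPos_apply, map_sub, map_smul]
  rw [fmul_matAct ε hF, fmul_matAct ε (fderiv_hasTemperateGrowth hF _), pos_matAct]

lemma weylPos_one (ε : ℝ) (i : Fin 3) (u : 𝓢(R3, C3)) :
    weylPos ε i (fun _ => 1) u = pos i u := by
  have h : fmul ε (fun _ => (0 : ℂ)) u = 0 :=
    schwartz_ext_fourier fun k => by
      rw [fourier_fmul ε (.const 0), zero_smul, FourierTransform.fourier_zero, zero_apply]
  simp [weylPos_apply, fmul_one, h]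

lemma weylPos_add (ε : ℝ) (i : Fin 3) {F G : R3 → ℂ} (hF : F.HasTemperateGrowth)
    (hG : G.HasTemperateGrowth) (u : 𝓢(R3, C3)) :
    weylPos ε i (fun ξ => F ξ + G ξ) u = weylPos ε i F u + weylPos ε i G u := by
  have hd : (fun ξ => fderiv ℝ (fun ξ => F ξ + G ξ) ξ (EuclideanSpace.single i (1 : ℝ))) =
      fun ξ => fderiv ℝ F ξ (EuclideanSpace.single i (1 : ℝ)) +
        fderiv ℝ G ξ (EuclideanSpace.single i (1 : ℝ)) := by
    ext1 ξ
    rw [fderiv_fun_add (hF.1.differentiable (by simp) ξ) (hG.1.differentiable (by simp) ξ)]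
    rfl
  simp only [weylPos_apply]
  rw [hd, fmul_add ε hF hG,
    fmul_add ε (fderiv_hasTemperateGrowth hF _) (fderiv_hasTemperateGrowth hG _), map_add]
  module

lemma fderiv_coord (i : Fin 3) (ξ v : R3) :
    fderiv ℝ (fun ξ : R3 => ((ξ i : ℝ) : ℂ)) ξ v = ((v i : ℝ) : ℂ) := by
  rw [show (fun ξ : R3 => ((ξ i : ℝ) : ℂ)) =
    ⇑(Complex.ofRealCLM ∘L (EuclideanSpace.proj i : R3 →L[ℝ] ℝ)) from rfl,
    ContinuousLinearMap.fderiv]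
  rfl

lemma fderiv_coord_mul {i j : Fin 3} (hij : j ≠ i) {F : R3 → ℂ} (hF : F.HasTemperateGrowth)
    (ξ : R3) :
    fderiv ℝ (fun ξ : R3 => ((ξ j : ℝ) : ℂ) * F ξ) ξ (EuclideanSpace.single i (1 : ℝ)) =
      ((ξ j : ℝ) : ℂ) * fderiv ℝ F ξ (EuclideanSpace.single i (1 : ℝ)) := by
  rw [fderiv_fun_mul ((coord_hasTemperateGrowth j).1.differentiable (by simp) ξ)
    (hF.1.differentiable (by simp) ξ), add_apply, smul_apply, smul_apply, fderiv_coord]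
  simp [hij]

lemma weylPos_fmul_coord (ε : ℝ) {i j : Fin 3} (hij : j ≠ i) {F : R3 → ℂ}
    (hF : F.HasTemperateGrowth) (u : 𝓢(R3, C3)) :
    weylPos ε i F (fmul ε (fun ξ => ((ξ j : ℝ) : ℂ)) u) =
      weylPos ε i (fun ξ => ((ξ j : ℝ) : ℂ) * F ξ) u := by
  simp only [weylPos_apply, fderiv_coord_mul hij hF]
  rw [fmul_fmul ε hF (coord_hasTemperateGrowth j),
    fmul_fmul ε (fderiv_hasTemperateGrowth hF _) (coord_hasTemperateGrowth j)]
  simp only [mul_comm]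

lemma fmul_coord_weylPos (ε : ℝ) {i j : Fin 3} (hij : j ≠ i) {F : R3 → ℂ}
    (hF : F.HasTemperateGrowth) (u : 𝓢(R3, C3)) :
    fmul ε (fun ξ => ((ξ j : ℝ) : ℂ)) (weylPos ε i F u) =
      weylPos ε i (fun ξ => ((ξ j : ℝ) : ℂ) * F ξ) u := by
  have h : fmul ε (fun _ => (0 : ℂ)) (fmul ε F u) = 0 :=
    schwartz_ext_fourier fun k => by
      rw [fourier_fmul ε (.const 0), zero_smul, FourierTransform.fourier_zero, zero_apply]
  have hz : ((EuclideanSpace.single i (1 : ℝ) : R3) j : ℝ) = 0 := by simp [hij]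
  simp only [weylPos_apply, fderiv_coord_mul hij hF, map_sub, map_smul]
  rw [fmul_pos ε (coord_hasTemperateGrowth j), fmul_fmul ε (coord_hasTemperateGrowth j) hF,
    fmul_fmul ε (coord_hasTemperateGrowth j) (fderiv_hasTemperateGrowth hF _)]
  simp only [fderiv_coord, hz, Complex.ofReal_zero, h, smul_zero, sub_zero]

/-- The composite of two operators with symbols proportional to `z₁` is `O(ε)` microlocally, since
`z₁² = ε η²` and every commutator with `z₁` gains a factor `ε`. -/
lemma hasMicroOrder_weylPos_comp {F G : R3 → ℂ} (hF : F.HasTemperateGrowth)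
    (hG : G.HasTemperateGrowth) :
    HasMicroOrder 2 fun ε => weylPos ε 1 F ∘L weylPos ε 1 G := by
  set D : (R3 → ℂ) → R3 → ℂ := fun F ξ => fderiv ℝ F ξ (EuclideanSpace.single 1 (1 : ℝ)) with hD
  have hDt : ∀ {F : R3 → ℂ}, F.HasTemperateGrowth → (D F).HasTemperateGrowth := fun h =>
    fderiv_hasTemperateGrowth h _
  have h2 : HasMicroOrder 2 fun ε => pos 1 ∘L (pos 1 ∘L fmul ε fun ξ => F ξ * G ξ) :=
    (HasMicroOrder.fmul (hF.mul hG)).pos_left.pos_left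
  have h1 : ∀ {H : R3 → ℂ}, H.HasTemperateGrowth →
      HasMicroOrder 2 fun ε => (ε : ℂ) • (pos 1 ∘L fmul ε H) := fun h =>
    (HasMicroOrder.fmul h).pos_left.eps_smul.mono (by norm_num)
  have h0 : ∀ {H : R3 → ℂ}, H.HasTemperateGrowth →
      HasMicroOrder 2 fun ε => (ε : ℂ) • (ε : ℂ) • fmul ε H := fun h =>
    (HasMicroOrder.fmul h).eps_smul.eps_smul.mono (by norm_num)
  have key := (((h2.add ((h1 ((hDt hF).mul hG)).const_smul (-3 * Complex.I / 2))).add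
    ((h1 (hF.mul (hDt hG))).const_smul (-Complex.I / 2))).add
    ((h0 ((hDt (hDt hF)).mul hG)).const_smul (-1 / 2))).add
    ((h0 ((hDt hF).mul (hDt hG))).const_smul (-1 / 4))
  refine key.congr fun ε u => ?_
  simp only [add_apply, smul_apply, ContinuousLinearMap.comp_apply, weylPos_apply, map_sub,
    map_smul]
  rw [fmul_pos ε hF, fmul_pos ε (hDt hF)]
  simp only [map_sub, map_smul]
  rw [fmul_fmul ε hF hG, fmul_fmul ε (hDt hF) hG, fmul_fmul ε (hDt (hDt hF)) hG,
    fmul_fmul ε hF (hDt hG), fmul_fmul ε (hDt hF) (hDt hG)]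
  match_scalars
  all_goals first
    | ring1
    | linear_combination ((ε : ℂ) ^ 2 / 2) * Complex.I_mul_I
    | linear_combination ((ε : ℂ) ^ 2 / 4) * Complex.I_mul_I

/-! ### Cancellation in the bracket -/

/-- The projection on the kernel of `J`. -/
def matP : Mat3 := !![0, 0, 0; 0, 0, 0; 0, 0, 1]

lemma matP_mul_matJ : matP * matJ = 0 := by
  ext i j; fin_cases i <;> fin_cases j <;> simp [matP, matJ, Matrix.mul_apply, Fin.sum_univ_three]

lemma matJ_mul_matP : matJ * matP = 0 := by
  ext i j; fin_cases i <;> fin_cases j <;> simp [matP, matJ, Matrix.mul_apply, Fin.sum_univ_three]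

lemma matL_mul_matP_add : matL * matP + matP * matL = matL := by
  ext i j; fin_cases i <;> fin_cases j <;>
    simp [matP, matL]

/-- A real-valued function, seen as complex-valued. -/
def cplx (f : R3 → ℝ) (ξ : R3) : ℂ := (f ξ : ℂ)

lemma cplx_hasTemperateGrowth {f : R3 → ℝ} (hf : IsSymbol f) : (cplx f).HasTemperateGrowth :=
  Complex.ofRealCLM.hasTemperateGrowth.comp hf.hasTemperateGrowth

lemma matAct_one (u : 𝓢(R3, C3)) : matAct 1 u = u := by ext1 x; simp

lemma matAct_zero (u : 𝓢(R3, C3)) : matAct 0 u = 0 := by ext1 x; simp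

lemma matAct_add (M N : Mat3) (u : 𝓢(R3, C3)) : matAct (M + N) u = matAct M u + matAct N u := by
  ext1 x; simp

/-- The quantization of `F(ξ) + s N + z₁ G(ξ) M`, the form of all the symbols in the theorem. -/
lemma isWeylQuantization_affine {ε : ℝ} (hε : 0 < ε) {F G : R3 → ℂ} (hF : F.HasTemperateGrowth)
    (hG : G.HasTemperateGrowth) (N M : Mat3) :
    IsWeylQuantization ε
      (fun p => F p.2 • (1 : Mat3) + (((p.1 0 : ℝ) : ℂ) * 1) • N + (((p.1 1 : ℝ) : ℂ) * G p.2) • M)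
      (fmul ε F ∘L matAct 1 + weylPos ε 0 (fun _ => 1) ∘L matAct N + weylPos ε 1 G ∘L matAct M) :=
  ((IsWeylQuantization.multiplier hε hF 1).add
    (IsWeylQuantization.coord_mul hε 0 (F := fun _ => 1) (.const 1) N)).add
    (IsWeylQuantization.coord_mul hε 1 hG M)

lemma opI_symbQ {ε : ℝ} (hε : 0 < ε) {α : R3 → ℝ} (hα : IsSymbol α) (u : 𝓢(R3, C3)) :
    opI ε (symbQ α ε) u = ⇑(pos 0 (matAct matJ u) + weylPos ε 1 (cplx α) (matAct matL u) -
      fmul ε (fun ξ => ((ξ 0 : ℝ) : ℂ)) u) := by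
  have hs : √ε ≠ 0 := (Real.sqrt_pos.2 hε).ne'
  have hc := coord_hasTemperateGrowth 0
  have hneg : Function.HasTemperateGrowth fun ξ : R3 => (-1 : ℂ) * ((ξ 0 : ℝ) : ℂ) :=
    (Function.HasTemperateGrowth.const (-1 : ℂ)).mul hc
  have h := (isWeylQuantization_affine hε hneg (cplx_hasTemperateGrowth hα) matJ matL).weylOp_eq u
  have e : (fun p : R3 × R3 => symbQ α ε (p.1, p.2, p.1 1 / √ε)) =
      fun p => ((-1 : ℂ) * ((p.2 0 : ℝ) : ℂ)) • (1 : Mat3) + (((p.1 0 : ℝ) : ℂ) * 1) • matJ +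
        (((p.1 1 : ℝ) : ℂ) * cplx α p.2) • matL := by
    ext1 p
    simp only [symbQ, cplx]
    rw [show √ε * α p.2 * (p.1 1 / √ε) = p.1 1 * α p.2 by field_simp]
    push_cast
    simp
  have hm : fmul ε (fun ξ : R3 => (-1 : ℂ) * ((ξ 0 : ℝ) : ℂ)) u =
      -fmul ε (fun ξ => ((ξ 0 : ℝ) : ℂ)) u := by
    refine schwartz_ext_fourier fun k => ?_
    rw [fourier_fmul ε hneg, ← neg_one_smul ℂ (fmul ε _ u), FourierTransform.fourier_smul,
      smul_apply, fourier_fmul ε hc, smul_smul]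
  rw [opI, e, h]
  simp only [add_apply, ContinuousLinearMap.comp_apply, matAct_one, weylPos_one, hm]
  congr 1
  abel

lemma opI_idAdd {ε : ℝ} (hε : 0 < ε) {β : R3 → ℝ} (hβ : IsSymbol β) (M : Mat3) (u : 𝓢(R3, C3)) :
    opI ε (idAdd ε fun p => ((p.2.2 * β p.2.1 : ℝ) : ℂ) • M) u =
      ⇑(u + weylPos ε 1 (cplx β) (matAct M u)) := by
  have hs : √ε ≠ 0 := (Real.sqrt_pos.2 hε).ne'
  have h := (isWeylQuantization_affine hε (F := fun _ => 1) (.const 1)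
    (cplx_hasTemperateGrowth hβ) 0 M).weylOp_eq u
  have e : (fun p : R3 × R3 => idAdd ε (fun p => ((p.2.2 * β p.2.1 : ℝ) : ℂ) • M)
      (p.1, p.2, p.1 1 / √ε)) =
      fun p => (1 : ℂ) • (1 : Mat3) + (((p.1 0 : ℝ) : ℂ) * 1) • (0 : Mat3) +
        (((p.1 1 : ℝ) : ℂ) * cplx β p.2) • M := by
    ext1 p
    simp only [idAdd, cplx]
    rw [smul_smul, ← Complex.ofReal_mul,
      show √ε * (p.1 1 / √ε * β p.2) = p.1 1 * β p.2 by field_simp]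
    push_cast
    simp
  rw [opI, e, h]
  simp only [add_apply, ContinuousLinearMap.comp_apply, matAct_one, matAct_zero, map_zero,
    fmul_one, add_zero]

/-- The bracket in `nfDefect`: a sum of products of two operators with symbols proportional to
`z₁`. -/
def nfBracket (α : R3 → ℝ) (ε : ℝ) : 𝓢(R3, C3) →L[ℂ] 𝓢(R3, C3) :=
  (weylPos ε 1 (cplx (hadamardQuotient α)) ∘L weylPos ε 1 (cplx α) +
    weylPos ε 1 (cplx fun ξ => α !₂[0, ξ 1, ξ 2]) ∘L weylPos ε 1 (cplx (hadamardQuotient α))) ∘L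
      matAct (matL * matP * matL)

lemma isSymbol_restrict {α : R3 → ℝ} (hα : IsSymbol α) :
    IsSymbol fun ξ : R3 => α !₂[0, ξ 1, ξ 2] := by
  have h : ∀ ξ : R3, shrink 0 ξ = !₂[0, ξ 1, ξ 2] := fun ξ => by
    rw [shrink_apply]; ext i; fin_cases i <;> simp
  simpa only [h] using hα.comp_clm (shrink 0)

/-- The terms of order zero and one cancel identically. -/
lemma nfDefect_eq {α : R3 → ℝ} (hα : IsSymbol α) {ε : ℝ} (hε : 0 < ε)
    (a : R3 × R3 × ℝ → Mat3) (u : 𝓢(R3, C3)) :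
    nfDefect α (fun p => ((p.2.2 * hadamardQuotient α p.2.1 : ℝ) : ℂ) • (matL * matP))
      (fun p => ((p.2.2 * hadamardQuotient α p.2.1 : ℝ) : ℂ) • (-(matP * matL))) a ε u =
      opI ε a (nfBracket α ε u) := by
  have hβ := isSymbol_hadamardQuotient hα
  have hα0 := isSymbol_restrict hα
  have tα := cplx_hasTemperateGrowth hα
  have tβ := cplx_hasTemperateGrowth hβ
  have tα0 := cplx_hasTemperateGrowth hα0
  have hc := coord_hasTemperateGrowth
  rw [nfDefect, opI_symbQ hε hα, opI_idAdd hε hβ, opI_idAdd hε hβ, symbQ0, opI_symbQ hε hα0]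
  congr 1
  rw [show ∀ f g : 𝓢(R3, C3), ⇑f - ⇑g = ⇑(f - g) from fun _ _ => rfl]
  congr 1
  -- the Hadamard decomposition of `α`, quantized
  have hsplit : ∀ v, weylPos ε 1 (cplx α) v =
      weylPos ε 1 (cplx fun ξ => α !₂[0, ξ 1, ξ 2]) v +
        weylPos ε 1 (fun ξ => ((ξ 0 : ℝ) : ℂ) * cplx (hadamardQuotient α) ξ) v := fun v => by
    refine Eq.trans ?_ (weylPos_add ε 1 tα0
      (G := fun ξ => ((ξ 0 : ℝ) : ℂ) * cplx (hadamardQuotient α) ξ) ((hc 0).mul tβ) v)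
    congr 2
    ext1 ξ
    have := coord_mul_hadamardQuotient hα.1 ξ
    simp only [cplx]
    rw [← Complex.ofReal_mul, this, ← Complex.ofReal_add]
    congr 1
    ring
  have hL : ∀ v, matAct matL v = matAct (matL * matP) v + matAct (matP * matL) v := fun v => by
    rw [← matAct_add, matL_mul_matP_add]
  have hneg : ∀ M v, matAct (-M) v = -matAct M v := fun M v => by ext1 x; simp
  have h10 : (0 : Fin 3) ≠ 1 := by decide
  -- the products with `s J` vanish
  have e1 : weylPos ε 1 (cplx (hadamardQuotient α)) (matAct (matL * matP) (pos 0 (matAct matJ u))) =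
      0 := by
    rw [← pos_matAct, matAct_matAct, Matrix.mul_assoc, matP_mul_matJ, Matrix.mul_zero, matAct_zero,
      map_zero, map_zero]
  have e2 : pos 0 (matAct matJ (weylPos ε 1 (cplx (hadamardQuotient α))
      (matAct (matP * matL) u))) = 0 := by
    rw [← weylPos_matAct ε 1 tβ, matAct_matAct, ← Matrix.mul_assoc, matJ_mul_matP, Matrix.zero_mul,
      matAct_zero, map_zero, map_zero]
  -- the second-order terms, which make up `nfBracket`
  have e3 : weylPos ε 1 (cplx (hadamardQuotient α)) (matAct (matL * matP)
      (weylPos ε 1 (cplx α) (matAct matL u))) = weylPos ε 1 (cplx (hadamardQuotient α))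
        (weylPos ε 1 (cplx α) (matAct (matL * matP * matL) u)) := by
    rw [← weylPos_matAct ε 1 tα, matAct_matAct]
  have e4 : weylPos ε 1 (cplx fun ξ => α !₂[0, ξ 1, ξ 2]) (matAct matL
      (weylPos ε 1 (cplx (hadamardQuotient α)) (matAct (matP * matL) u))) =
      weylPos ε 1 (cplx fun ξ => α !₂[0, ξ 1, ξ 2])
        (weylPos ε 1 (cplx (hadamardQuotient α)) (matAct (matL * matP * matL) u)) := by
    rw [← weylPos_matAct ε 1 tβ, matAct_matAct, Matrix.mul_assoc]
  -- the products with `σ(εD)`, to be cancelled by the first-order part of `α - α(0, ·)`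
  have e5 : weylPos ε 1 (cplx (hadamardQuotient α)) (matAct (matL * matP)
      (fmul ε (fun ξ => ((ξ 0 : ℝ) : ℂ)) u)) =
      weylPos ε 1 (fun ξ => ((ξ 0 : ℝ) : ℂ) * cplx (hadamardQuotient α) ξ)
        (matAct (matL * matP) u) := by
    rw [← fmul_matAct ε (hc 0), weylPos_fmul_coord ε h10 tβ]
  have e6 := hL u
  apply_fun weylPos ε 1 (fun ξ => ((ξ 0 : ℝ) : ℂ) * cplx (hadamardQuotient α) ξ) at e6
  rw [map_add] at e6
  simp only [nfBracket, ContinuousLinearMap.comp_apply, add_apply, map_add, map_sub, map_neg, hneg,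
    fmul_coord_weylPos ε h10 tβ, e1, e2, e3, e4, e5]
  rw [hsplit (matAct matL u), e6]
  abel

/-! ### Norm estimate and extension to `L²` -/

lemma isMatrixSymbol_smul {β : R3 → ℝ} (hβ : IsSymbol β) (M : Mat3) :
    IsMatrixSymbol fun p : R3 × R3 × ℝ => ((p.2.2 * β p.2.1 : ℝ) : ℂ) • M := by
  intro i j
  have h1 : IsSymbol fun p : R3 × R3 × ℝ => p.2.2 * β p.2.1 :=
    (IsSymbol.clm (ContinuousLinearMap.snd ℝ R3 ℝ ∘L ContinuousLinearMap.snd ℝ R3 (R3 × ℝ))).mul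
      (hβ.comp_clm (ContinuousLinearMap.fst ℝ R3 ℝ ∘L ContinuousLinearMap.snd ℝ R3 (R3 × ℝ)))
  have h2 := h1.clm_comp (ContinuousLinearMap.toSpanSingleton ℝ (M i j))
  simpa using h2

lemma isTestSymbol_toEuclideanCLM {a : R3 × R3 × ℝ → Mat3}
    (ha : ∀ i j : Fin 3, ContDiff ℝ ∞ fun p => a p i j) (hc : HasCompactSupport a) :
    IsTestSymbol fun p => Matrix.toEuclideanCLM (n := Fin 3) (𝕜 := ℂ) (a p) := by
  constructor
  · have e : (fun p => Matrix.toEuclideanCLM (n := Fin 3) (𝕜 := ℂ) (a p)) = fun p =>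
        ∑ i, ∑ j, a p i j •
          Matrix.toEuclideanCLM (n := Fin 3) (𝕜 := ℂ) (Matrix.single i j (1 : ℂ)) := by
      ext1 p
      conv_lhs => rw [Matrix.matrix_eq_sum_single (a p)]
      simp only [map_sum, ← map_smul, Matrix.smul_single, smul_eq_mul, mul_one]
    rw [e]
    exact ContDiff.sum fun i _ => ContDiff.sum fun j _ => (ha i j).smul contDiff_const
  · exact hc.comp_left (g := fun M : Mat3 => Matrix.toEuclideanCLM (n := Fin 3) (𝕜 := ℂ) M)
      (map_zero _)

lemma hasMicroOrder_nfBracket {α : R3 → ℝ} (hα : IsSymbol α) : HasMicroOrder 2 (nfBracket α) := by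
  have tα := cplx_hasTemperateGrowth hα
  have tβ := cplx_hasTemperateGrowth (isSymbol_hadamardQuotient hα)
  have tα0 := cplx_hasTemperateGrowth (isSymbol_restrict hα)
  exact ((hasMicroOrder_weylPos_comp tβ tα).add (hasMicroOrder_weylPos_comp tα0 tβ)).comp_right
    (V := fun _ => matAct (matL * matP * matL)) (norm_nonneg _) fun _ u => eLpNorm_matAct_le _ u

/-- Schwartz functions are dense in `L²`, so an `L²` estimate on them gives a bounded operator. -/
lemma IsTestSymbol.exists_clm_extension {A : R3 × R3 × ℝ → C3 →L[ℂ] C3} (hA : IsTestSymbol A)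
    {ε K : ℝ} (hK : 0 ≤ K) (W : 𝓢(R3, C3) →L[ℂ] 𝓢(R3, C3))
    (h : ∀ u, eLpNorm (quant ε A (W u)) 2 volume ≤ ENNReal.ofReal K * eLpNorm u 2 volume) :
    ∃ T : L2R3 →L[ℂ] L2R3,
      (∀ u : 𝓢(R3, C3), (T (u.toLp 2 volume) : R3 → C3) =ᵐ[volume] quant ε A (W u)) ∧
        ‖T‖ ≤ K := by
  have hm : ∀ u, MemLp (quant ε A (W u)) 2 volume := fun u =>
    ⟨hA.aestronglyMeasurable_quant ε (W u).continuous, (h u).trans_lt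
      (ENNReal.mul_lt_top ENNReal.ofReal_lt_top (u.memLp 2 volume).eLpNorm_lt_top)⟩
  let f : 𝓢(R3, C3) →ₗ[ℂ] L2R3 :=
    { toFun := fun u => (hm u).toLp _
      map_add' := fun u v => by
        rw [← MemLp.toLp_add]
        refine MemLp.toLp_congr _ _ (Eventually.of_forall fun x => ?_)
        rw [← quant_add hA ε (W u).continuous (W v).continuous, map_add]
        rfl
      map_smul' := fun c u => by
        rw [RingHom.id_apply, ← MemLp.toLp_const_smul]
        refine MemLp.toLp_congr _ _ (Eventually.of_forall fun x => ?_)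
        rw [← quant_smul, map_smul]
        rfl }
  let e : 𝓢(R3, C3) →ₗ[ℂ] L2R3 := (SchwartzMap.toLpCLM ℂ C3 2 volume).toLinearMap
  have hd : DenseRange e := SchwartzMap.denseRange_toLpCLM (p := 2) ENNReal.ofNat_ne_top
  have hn : ∀ u, ‖f u‖ ≤ K * ‖e u‖ := fun u => by
    have h1 : ‖e u‖ = (eLpNorm u 2 volume).toReal := SchwartzMap.norm_toLp
    have h2 : ‖f u‖ = (eLpNorm (quant ε A (W u)) 2 volume).toReal := Lp.norm_toLp _ (hm u)
    have h3 := ENNReal.toReal_mono (ENNReal.mul_ne_top ENNReal.ofReal_ne_top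
      (u.memLp 2 volume).eLpNorm_ne_top) (h u)
    rwa [ENNReal.toReal_mul, ENNReal.toReal_ofReal hK, ← h1, ← h2] at h3
  refine ⟨f.extendOfNorm e, fun u => ?_, LinearMap.opNorm_extendOfNorm_le hd hK hn⟩
  have h1 : f.extendOfNorm e (u.toLp 2 volume) = f u := LinearMap.extendOfNorm_eq hd ⟨K, hn⟩ u
  rw [h1]
  exact (hm u).coeFn_toLp

end

theorem proposition2 (α : R3 → ℝ) (hα : IsSymbol α) (η₀ r : ℝ) :
    ∃ C C' : R3 × R3 × ℝ → Mat3, IsMatrixSymbol C ∧ IsMatrixSymbol C' ∧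
      ∀ a : R3 × R3 × ℝ → Mat3, (∀ i j : Fin 3, ContDiff ℝ ∞ fun p => a p i j) →
        HasCompactSupport a → (∀ p ∈ tsupport a, p.2.2 ∈ Metric.ball η₀ r) →
        ∃ T : ℝ → (L2R3 →L[ℂ] L2R3),
          (∀ ε : ℝ, 0 < ε → ∀ u : 𝓢(R3, C3),
            (T ε (u.toLp 2 volume) : R3 → C3) =ᵐ[volume] nfDefect α C C' a ε u) ∧
          (fun ε => ‖T ε‖) =O[𝓝[>] (0 : ℝ)] (fun ε => ε) := by
  have hβ := isSymbol_hadamardQuotient hα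
  refine ⟨fun p => ((p.2.2 * hadamardQuotient α p.2.1 : ℝ) : ℂ) • (matL * matP),
    fun p => ((p.2.2 * hadamardQuotient α p.2.1 : ℝ) : ℂ) • (-(matP * matL)),
    isMatrixSymbol_smul hβ _, isMatrixSymbol_smul hβ _, fun a ha hc _ => ?_⟩
  have hA := isTestSymbol_toEuclideanCLM ha hc
  have hW := hasMicroOrder_nfBracket hα
  obtain ⟨K, hK0, hK⟩ := hW _ hA 1 one_pos
  have key : ∀ ε : ℝ, ∃ T : L2R3 →L[ℂ] L2R3, (0 < ε → ∀ u : 𝓢(R3, C3),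
      (T (u.toLp 2 volume) : R3 → C3) =ᵐ[volume]
        quant ε (fun p => Matrix.toEuclideanCLM (n := Fin 3) (𝕜 := ℂ) (a p)) (nfBracket α ε u)) ∧
      (0 < ε → ε ≤ 1 → ‖T‖ ≤ K * ε) := by
    intro ε
    rcases le_or_gt ε 0 with h0 | h0
    · exact ⟨0, fun h => absurd h h0.not_gt, fun h => absurd h h0.not_gt⟩
    rcases le_or_gt ε 1 with h1 | h1
    · obtain ⟨T, hT, hn⟩ := hA.exists_clm_extension (K := K * √ε ^ 2) (by positivity)
        (nfBracket α ε) (hK ε h0 h1)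
      rw [Real.sq_sqrt h0.le] at hn
      exact ⟨T, fun _ => hT, fun _ _ => hn⟩
    -- the constants in `HasMicroOrder` are uniform on bounded sets of `ε` only
    · obtain ⟨K', hK0', hK'⟩ := hW _ hA ε h0
      obtain ⟨T, hT, -⟩ := hA.exists_clm_extension (K := K' * √ε ^ 2) (by positivity)
        (nfBracket α ε) (hK' ε h0 le_rfl)
      exact ⟨T, fun _ => hT, fun _ h => absurd h h1.not_ge⟩
  choose T hT hn using key
  refine ⟨T, fun ε hε u => ?_, IsBigO.of_bound K ?_⟩
  · rw [nfDefect_eq hα hε, opI_eq_quant]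
    exact hT ε hε u
  · filter_upwards [Ioc_mem_nhdsGT (zero_lt_one' ℝ)] with ε hε
    rw [norm_norm, Real.norm_of_nonneg hε.1.le]
    exact hn ε hε.1 hε.2
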